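/- Let $n\ge 1$, and equip $\mathbb R^{2n}$, with coordinates $(q_1,\dots,q_n,p_1,\dots,p_n)$, with the $1$-form $\alpha=\frac12\sum_{i=1}^n(p_i\,dq_i-q_i\,dp_i)$. "Homogeneous of degree $2$" means $F(cx)=c^2F(x)$ for all $c>0$. A smooth star-shaped hypersurface is a level set $\Sigma=\{H_\Sigma=1\}$, where $H_\Sigma:\mathbb R^{2n}\to[0,\infty)$ is proper, smooth outside the origin and homogeneous of degree $2$; $H_\Sigma$ is uniquely determined by $\Sigma$ and is called the Hamiltonian associated with $\Sigma$. The restriction of $\alpha$ to $\Sigma$ is a contact form; its Reeb field $X$ is defined by $d\alpha(X,\cdot)=0$ on $T\Sigma$ and $\alpha(X)=1$. Put $$\mathrm{vol}(\Sigma)=\frac1{n!}\int_\Sigma\alpha\wedge(d\alpha)^{n-1},\qquad \mathrm{sys}(\Sigma)=\inf_\gamma\int_\gamma\alpha,\qquad \mathfrak S(\Sigma)=\frac{\mathrm{vol}(\Sigma)}{\mathrm{sys}(\Sigma)^n},$$ where $\Sigma$ is oriented by the volume form $\alpha\wedge(d\alpha)^{n-1}$ and $\gamma$ runs over the closed orbits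 of the Reeb flow ($\mathrm{sys}(\Sigma)=\infty$ if there are none). **Theorem.** Let $\Sigma_0$ be a smooth star-shaped hypersurface of $\mathbb R^{2n}$, with associated Hamiltonian $H_0$, whose Reeb flow is periodic with period $\mathrm{sys}(\Sigma_0)$. Let $N\ge 0$ be an integer and let $H_1,\dots,H_N:\mathbb R^{2n}\to\mathbb R$ be arbitrary functions that are smooth outside the origin and homogeneous of degree $2$. Then there exist $\varepsilon>0$ and a family of smooth star-shaped hypersurfaces $(\Sigma_t)_{|t|<\varepsilon}$, equal to the given $\Sigma_0$ at $t=0$, whose associated Hamiltonians $H_t=H_{\Sigma_t}$ depend smoothly on $(t,x)\in(-\varepsilon,\varepsilon)\times(\mathbb R^{2n}\setminus\{0\})$, such that $$H_t=H_0+tH_1+\dots+t^NH_N+o(t^N)\qquad (t\to0),$$ uniformly on the unit sphere, that is, the remainder at $x$ is bounded by $\eta(t)\,|t|^N\|x\|^2$ for all $x$, with $\eta(t)\to0$, and $$\mathfrak S(\Sigma_t)\ge\mathfrak S(\Sigma_0)\qquad\text{for all } |t|<\varepsilon .$$ -/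

import Mathlib

open Set Filter Topology MeasureTheory
open scoped ContDiff ENNReal

noncomputable section

namespace Starshaped

/-- The space `ℝ²ⁿ` with its Euclidean structure. The coordinate `Sum.inl i` is `qᵢ` and the
coordinate `Sum.inr i` is `pᵢ`. -/
abbrev PhaseSpace (n : ℕ) : Type := EuclideanSpace ℝ (Fin n ⊕ Fin n)

variable {n : ℕ}

/-- The 1-form `α = ½ ∑ᵢ (pᵢ dqᵢ - qᵢ dpᵢ)`, at the point `x`, evaluated on the vector `v`. -/
def liouville (x v : PhaseSpace n) : ℝ :=
  (1 / 2) * ∑ i : Fin n, (x (Sum.inr i) * v (Sum.inl i) - x (Sum.inl i) * v (Sum.inr i))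

/-- The exterior derivative `dα` at the point `x`, evaluated on `(u, v)`:
`dα(u, v) = u(α(v)) - v(α(u))`, where `u` and `v` are extended to constant vector fields. -/
def dLiouville (x u v : PhaseSpace n) : ℝ :=
  fderiv ℝ (fun y => liouville y v) x u - fderiv ℝ (fun y => liouville y u) x v

/-- The `(2k+1)`-form `α ∧ (dα)^k` at the point `x`, evaluated on `(v₀, …, v₂ₖ)`, with the
normalisation of the wedge product for which `dx₁ ∧ ⋯ ∧ dxₘ` is the determinant. -/
def contactTopForm (k : ℕ) (x : PhaseSpace n) (v : Fin (2 * k + 1) → PhaseSpace n) : ℝ :=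
  (1 / 2 ^ k) * ∑ σ : Equiv.Perm (Fin (2 * k + 1)),
    ((Equiv.Perm.sign σ : ℤ) : ℝ) * liouville x (v (σ 0)) *
      ∏ j : Fin k, dLiouville x (v (σ ⟨2 * (j : ℕ) + 1, by omega⟩))
        (v (σ ⟨2 * (j : ℕ) + 2, by omega⟩))

/-- `F` is smooth outside the origin and (positively) homogeneous of degree `2`. -/
structure IsHomogeneousSmooth (F : PhaseSpace n → ℝ) : Prop where
  smooth : ContDiffOn ℝ ∞ F {0}ᶜ
  homogeneous : ∀ c : ℝ, 0 < c → ∀ x, F (c • x) = c ^ 2 * F x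

/-- `H : ℝ²ⁿ → [0, ∞)` is proper, smooth outside the origin and homogeneous of degree `2`.
Smooth starshaped hypersurfaces are the level sets `{H = 1}` of such functions, and `H` is then
the Hamiltonian associated with the hypersurface. -/
structure IsStarHamiltonian (H : PhaseSpace n → ℝ) : Prop extends IsHomogeneousSmooth H where
  nonneg : ∀ x, 0 ≤ H x
  proper : Tendsto H (cocompact (PhaseSpace n)) atTop

/-- The hypersurface `{H = 1}`. -/
def energySurface (H : PhaseSpace n → ℝ) : Set (PhaseSpace n) := {x | H x = 1}

/-- `X` is the value at `x` of the Reeb field of the restriction of `α` to `{H = 1}`, whose tangent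
space at `x` is the kernel of `dH(x)`. -/
structure IsReebVector (H : PhaseSpace n → ℝ) (x X : PhaseSpace n) : Prop where
  tangent : fderiv ℝ H x X = 0
  kernel : ∀ v, fderiv ℝ H x v = 0 → dLiouville x X v = 0
  normalized : liouville x X = 1

/-- `γ` is an orbit of the Reeb flow on `{H = 1}`, that is, a characteristic. -/
structure IsCharacteristic (H : PhaseSpace n → ℝ) (γ : ℝ → PhaseSpace n) : Prop where
  mem : ∀ t, γ t ∈ energySurface H
  differentiable : Differentiable ℝ γ
  reeb : ∀ t, IsReebVector H (γ t) (deriv γ t)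

/-- The action `∫_γ α` of the curve `γ`, restricted to `[0, T]`. -/
def action (γ : ℝ → PhaseSpace n) (T : ℝ) : ℝ :=
  ∫ t in (0 : ℝ)..T, liouville (γ t) (deriv γ t)

/-- The systole of `{H = 1}`: the infimum of the actions of the closed characteristics, equal to
`∞` when there are none. -/
def systole (H : PhaseSpace n → ℝ) : ℝ≥0∞ :=
  ⨅ (γ : ℝ → PhaseSpace n) (T : ℝ) (_ : IsCharacteristic H γ ∧ 0 < T ∧ Function.Periodic γ T),
    ENNReal.ofReal (action γ T)

/-- The Reeb flow on `{H = 1}` is periodic with period `T`: the orbit of every point is defined for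
all times and closes up after time `T`. -/
def HasPeriodicReebFlow (H : PhaseSpace n → ℝ) (T : ℝ) : Prop :=
  0 < T ∧ ∀ x ∈ energySurface H,
    ∃ γ : ℝ → PhaseSpace n, IsCharacteristic H γ ∧ γ 0 = x ∧ Function.Periodic γ T

/-- The radial projection onto `{H = 1}`; its restriction to the unit sphere is a diffeomorphism
from the unit sphere onto `{H = 1}`. -/
def radialMap (H : PhaseSpace n → ℝ) (y : PhaseSpace n) : PhaseSpace n :=
  (Real.sqrt (H y))⁻¹ • y

/-- The orthonormal bases of the tangent space at `x` of the unit sphere `S²ⁿ⁻¹` (for `n ≥ 1`). -/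
def tangentFrames (x : PhaseSpace n) : Set (Fin (2 * (n - 1) + 1) → PhaseSpace n) :=
  {e | Orthonormal ℝ e ∧ ∀ i, inner ℝ x (e i) = 0}

/-- The density at a point `x` of the unit sphere, with respect to the surface measure, of the
pull-back of `α ∧ (dα)^(n-1)` by the radial diffeomorphism: the absolute value of the pulled back
form on an orthonormal basis of the tangent space. This does not depend on the basis, so that the
supremum is over a family with only one value. -/
def volumeDensity (H : PhaseSpace n → ℝ) (x : PhaseSpace n) : ℝ≥0∞ :=
  ⨆ e ∈ tangentFrames x,
    ENNReal.ofReal |contactTopForm (n - 1) (radialMap H x)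
      (fun i => fderiv ℝ (radialMap H) x (e i))|

/-- The contact volume `(1 / n!) ∫ α ∧ (dα)^(n-1)` of `{H = 1}`, oriented by the volume form
`α ∧ (dα)^(n-1)`. The integral is computed on the unit sphere, with its surface measure, through
the radial diffeomorphism. -/
def contactVolume (H : PhaseSpace n → ℝ) : ℝ≥0∞ :=
  (n.factorial : ℝ≥0∞)⁻¹ *
    ∫⁻ x : Metric.sphere (0 : PhaseSpace n) 1, volumeDensity H (x : PhaseSpace n)
      ∂(volume : Measure (PhaseSpace n)).toSphere

/-- The systolic volume `vol / sysⁿ` of `{H = 1}`. -/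
def systolicVolume (H : PhaseSpace n → ℝ) : ℝ≥0∞ :=
  contactVolume H / systole H ^ n

end Starshaped

end

/-!
The prescribed deformation can be brought into normal form. The Hamiltonian flow of `H₀` is
periodic on the complement of the origin. A deformation `H₀ + t F + ⋯` is pulled back by the
symplectic map generated by `t S`, which changes the coefficient of `t` by the Poisson bracket
`{H₀, S}`; if `S` solves the homological equation, the new coefficient is the average of `F` over
the orbits of `H₀`. Repeating this with powers of `t` shows that, for a family `Ψ t` of symplectic
diffeomorphisms that are homogeneous of degree one,
`(H₀ + t H₁ + ⋯ + t ^ N H_N) ∘ Ψ t = K t + O(t ^ (N + 1))`,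
where each `K t` is an integral of motion of the flow of `H₀` (`exists_isNormalForm`). The
Hamiltonian of the hypersurface `Σ_t` is then `H t = K t ∘ (Ψ t)⁻¹`. Each step uses only the
velocity of the symplectic maps at the identity, so that they may be taken to be the Cayley
transforms `x ↦ y`, `y - x = s J ∇S((x + y) / 2)` (`exists_isSymplecticFamily`), whose smoothness
needs no more than the inverse function theorem. The smoothness of the averages and of `S` rests on
the smooth dependence of the flow of `H₀` on the initial value
(`IsCompleteFlow.contDiffOn_uncurry`).

The systolic inequality holds exactly, with no error term, for such `H t` (`systolicVolume_le`).
Let `M` be the maximum of `K t / H₀`. The maximum is attained along a whole orbit of `H₀`, since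
both functions are invariant, and there `d(K t) = M dH₀`. Hence this orbit, rescaled, is a closed
characteristic of `K t` of period `T / M`, and `Ψ t` carries it to one of `H t`, so that the
systole is at most `T / M`. The volume is a constant multiple of the Lebesgue measure of `{H t <
1}` (`exists_contactVolume_eq`), which equals that of `{K t < 1}` because `Ψ t` preserves volume,
and `K t ≤ M H₀` bounds it below by `M⁻ⁿ` times that of `{H₀ < 1}`. The powers of `M` cancel in the
systolic volume.
-/

namespace Starshaped

/-! ### Smooth dependence of flows on the initial value -/

universe u

section SmoothFlow

variable {E : Type u} [NormedAddCommGroup E] [NormedSpace ℝ E]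

/-- Around each point a smooth vector field is Lipschitz and has a uniform quadratic Taylor
bound. -/
theorem exists_ball_lipschitz_quadratic {X : E → E} {U : Set E} (hU : IsOpen U)
    (hX : ContDiffOn ℝ ∞ X U) {x₀ : E} (hx₀ : x₀ ∈ U) :
    ∃ R > 0, ∃ K : NNReal, ∃ C : ℝ, 0 ≤ C ∧ Metric.ball x₀ R ⊆ U ∧
      LipschitzOnWith K X (Metric.ball x₀ R) ∧
      ∀ x ∈ Metric.ball x₀ R, ∀ y ∈ Metric.ball x₀ R,
        ‖X y - X x - fderiv ℝ X x (y - x)‖ ≤ C * ‖y - x‖ ^ 2 := by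
  have hXa : ContDiffAt ℝ ∞ X x₀ := hX.contDiffAt (hU.mem_nhds hx₀)
  obtain ⟨K, s, hs, hl⟩ := (hXa.of_le (by exact_mod_cast le_top) :
    ContDiffAt ℝ 1 X x₀).exists_lipschitzOnWith
  have hd : ContDiffOn ℝ ∞ (fderiv ℝ X) U := hX.fderiv_of_isOpen hU (by simp)
  obtain ⟨K', s', hs', hl'⟩ := ((hd.contDiffAt (hU.mem_nhds hx₀)).of_le
    (by exact_mod_cast le_top) : ContDiffAt ℝ 1 (fderiv ℝ X) x₀).exists_lipschitzOnWith
  obtain ⟨R, hR, hsub⟩ := Metric.mem_nhds_iff.mp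
    (Filter.inter_mem (Filter.inter_mem hs hs') (hU.mem_nhds hx₀))
  refine ⟨R, hR, K, K', K'.2, fun x hx => (hsub hx).2,
    hl.mono fun x hx => (hsub hx).1.1, fun x hx y hy => ?_⟩
  have hseg : segment ℝ x y ⊆ Metric.ball x₀ R := (convex_ball x₀ R).segment_subset hx hy
  have key := (convex_segment x y).norm_image_sub_le_of_norm_hasFDerivWithin_le'
    (f := X) (f' := fderiv ℝ X) (φ := fderiv ℝ X x) (C := K' * ‖y - x‖)
    (fun z hz => (((hX.contDiffAt (hU.mem_nhds (hsub (hseg hz)).2)).differentiableAt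
      (by simp)).hasFDerivAt).hasFDerivWithinAt)
    (fun z hz => by
      have h1 := hl'.dist_le_mul z (hsub (hseg hz)).1.2 x (hsub hx).1.2
      rw [dist_eq_norm, dist_eq_norm] at h1
      refine h1.trans ?_
      gcongr
      exact norm_sub_le_of_mem_segment hz)
    (left_mem_segment ℝ x y) (right_mem_segment ℝ x y)
  rw [pow_two, ← mul_assoc]
  exact key

/-- A solution of `w' = X w` and a curve `f + A h` built from a solution `f` and a solution `A` of
the linearised equation along `f` differ by at most a constant times `‖h‖²`. -/
theorem norm_sub_sub_le_of_linearization {X : E → E} {B : Set E} {K : NNReal} {C δ : ℝ}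
    (hC : 0 ≤ C) (hl : LipschitzOnWith K X B)
    (hq : ∀ x ∈ B, ∀ y ∈ B, ‖X y - X x - fderiv ℝ X x (y - x)‖ ≤ C * ‖y - x‖ ^ 2)
    {f g : ℝ → E} {A : ℝ → E →L[ℝ] E} {h : E}
    (hf : ∀ t ∈ Ico 0 δ, HasDerivAt f (X (f t)) t) (hg : ∀ t ∈ Ico 0 δ, HasDerivAt g (X (g t)) t)
    (hA : ∀ t ∈ Ico 0 δ, HasDerivAt A ((fderiv ℝ X (f t)).comp (A t)) t)
    (hfB : ∀ t ∈ Ico 0 δ, f t ∈ B) (hgB : ∀ t ∈ Ico 0 δ, g t ∈ B)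
    (hAB : ∀ t ∈ Ico 0 δ, f t + A t h ∈ B) (hA2 : ∀ t ∈ Ico 0 δ, ‖A t‖ ≤ 2)
    (h0 : g 0 = f 0 + A 0 h) {t : ℝ} (ht : t ∈ Ico 0 δ) :
    ‖g t - f t - A t h‖ ≤ 4 * C / (K + 1) * (Real.exp ((K + 1) * t) - 1) * ‖h‖ ^ 2 := by
  have hsub : Icc 0 t ⊆ Ico 0 δ := fun s hs => ⟨hs.1, hs.2.trans_lt ht.2⟩
  have hw : ∀ s ∈ Ico 0 δ, HasDerivAt (fun s => f s + A s h)
      (X (f s) + fderiv ℝ X (f s) (A s h)) s := fun s hs =>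
    (hf s hs).add ((hA s hs).clm_apply (hasDerivAt_const s h) |>.congr_deriv (by simp))
  have key := dist_le_of_approx_trajectories_ODE_of_mem (v := fun _ => X) (s := fun _ => B)
    (K := K + 1) (a := 0) (b := t) (f := g) (g := fun s => f s + A s h)
    (f' := fun s => X (g s)) (g' := fun s => X (f s) + fderiv ℝ X (f s) (A s h))
    (εf := 0) (εg := 4 * C * ‖h‖ ^ 2) (δ := 0)
    (fun _ _ => hl.weaken (by simp))
    (fun s hs => (hg s (hsub hs)).continuousAt.continuousWithinAt)
    (fun s hs => (hg s (hsub ⟨hs.1, hs.2.le⟩)).hasDerivWithinAt)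
    (fun s hs => by simp) (fun s hs => hgB s (hsub ⟨hs.1, hs.2.le⟩))
    (fun s hs => (hw s (hsub hs)).continuousAt.continuousWithinAt)
    (fun s hs => (hw s (hsub ⟨hs.1, hs.2.le⟩)).hasDerivWithinAt)
    (fun s hs => by
      have hs' := hsub ⟨hs.1, hs.2.le⟩
      have h1 := hq (f s) (hfB s hs') (f s + A s h) (hAB s hs')
      rw [add_sub_cancel_left] at h1
      rw [dist_comm, dist_eq_norm, ← sub_sub]
      refine h1.trans ?_
      have h2 : ‖A s h‖ ≤ 2 * ‖h‖ := (A s).le_of_opNorm_le (hA2 s hs') h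
      calc C * ‖A s h‖ ^ 2 ≤ C * (2 * ‖h‖) ^ 2 := by gcongr
        _ = 4 * C * ‖h‖ ^ 2 := by ring)
    (fun s hs => hAB s (hsub ⟨hs.1, hs.2.le⟩)) (by simp [h0]) t ⟨ht.1, le_rfl⟩
  rw [dist_eq_norm, ← sub_sub, gronwallBound_of_K_ne_0 (by positivity)] at key
  refine key.trans (le_of_eq ?_)
  push_cast
  simp only [zero_mul, zero_add, sub_zero]
  ring

/-- The local flow of a smooth vector field depends on the initial value in a `C^k` way, for each
`k`. The derivative of the flow is the solution of the linearised equation, so the statement for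
`k + 1` follows from the one for `k`, applied to the field `(x, A) ↦ (X x, DX x ∘ A)`. -/
theorem exists_local_flow_contDiffOn (k : ℕ) : ∀ (E : Type u) [NormedAddCommGroup E]
    [NormedSpace ℝ E] [CompleteSpace E] (X : E → E) (U : Set E), IsOpen U → ContDiffOn ℝ ∞ X U →
    ∀ x₀ ∈ U, ∃ δ > 0, ∃ r > 0, ∃ φ : E → ℝ → E,
      (∀ x ∈ Metric.ball x₀ r, φ x 0 = x ∧
        ∀ t ∈ Ico 0 δ, φ x t ∈ U ∧ HasDerivAt (φ x) (X (φ x t)) t) ∧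
      ∀ t ∈ Ico 0 δ, ContDiffOn ℝ k (fun x => φ x t) (Metric.ball x₀ r) := by
  induction k with
  | zero =>
    intro E _ _ _ X U hU hX x₀ hx₀
    obtain ⟨ε, hε, a, r, L, K, hr, hPL⟩ := IsPicardLindelof.of_contDiffAt_one
      ((hX.contDiffAt (hU.mem_nhds hx₀)).of_le (by exact_mod_cast le_top) : ContDiffAt ℝ 1 X x₀)
    obtain ⟨α, hα, hc⟩ := (hPL 0).exists_forall_mem_closedBall_eq_hasDerivWithinAt_continuousOn
    simp only [zero_sub, zero_add] at hα hc
    have hnhds : Metric.closedBall x₀ r ×ˢ Icc (-ε) ε ∈ 𝓝 (x₀, (0 : ℝ)) :=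
      prod_mem_nhds (Metric.closedBall_mem_nhds _ hr) (Icc_mem_nhds (by linarith) hε)
    have hca : ContinuousAt α (x₀, 0) := hc.continuousAt hnhds
    have hev : ∀ᶠ z in 𝓝 (x₀, (0 : ℝ)), α z ∈ U := hca.eventually_mem (by
      rw [(hα x₀ (by simp)).1]; exact hU.mem_nhds hx₀)
    obtain ⟨ρ, hρ, hsub⟩ := Metric.mem_nhds_iff.mp (Filter.inter_mem hev hnhds)
    have hmem : ∀ x ∈ Metric.ball x₀ ρ, ∀ t ∈ Ico (0 : ℝ) (min ρ ε),
        (x, t) ∈ Metric.ball (x₀, (0 : ℝ)) ρ := by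
      intro x hx t ht
      rw [← ball_prod_same]
      refine ⟨hx, ?_⟩
      simp only [Metric.mem_ball, dist_zero_right, Real.norm_eq_abs, abs_of_nonneg ht.1]
      exact ht.2.trans_le (min_le_left _ _)
    refine ⟨min ρ ε, lt_min hρ hε, ρ, hρ, fun x t => α (x, t), fun x hx => ⟨?_, fun t ht => ?_⟩,
      fun t ht => ?_⟩
    · exact (hα x (hsub (hmem x hx 0 ⟨le_rfl, lt_min hρ hε⟩)).2.1).1
    · refine ⟨(hsub (hmem x hx t ht)).1, ?_⟩
      refine ((hα x (hsub (hmem x hx t ht)).2.1).2 t (hsub (hmem x hx t ht)).2.2).hasDerivAt ?_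
      exact Icc_mem_nhds (by linarith [ht.1]) (ht.2.trans_le (min_le_right _ _))
    · simp only [Nat.cast_zero]
      rw [contDiffOn_zero]
      exact hc.comp (by fun_prop) fun x hx => (hsub (hmem x hx t ht)).2
  | succ k ih =>
    intro E _ _ _ X U hU hX x₀ hx₀
    obtain ⟨R, hR, K, C, hC, hRU, hl, hq⟩ := exists_ball_lipschitz_quadratic hU hX hx₀
    have hR2 : Metric.ball x₀ (R / 2) ⊆ Metric.ball x₀ R := Metric.ball_subset_ball (by linarith)
    obtain ⟨δ, hδ, r, hr, φ, hφ, hsm⟩ := ih (E × (E →L[ℝ] E))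
      (fun z => (X z.1, (fderiv ℝ X z.1).comp z.2))
      (Metric.ball x₀ (R / 2) ×ˢ Metric.ball (ContinuousLinearMap.id ℝ E) 1)
      (Metric.isOpen_ball.prod Metric.isOpen_ball) (by
        have h1 : ContDiffOn ℝ ∞ (fderiv ℝ X) U := hX.fderiv_of_isOpen hU (by simp)
        have hm : MapsTo (Prod.fst : E × (E →L[ℝ] E) → E)
          (Metric.ball x₀ (R / 2) ×ˢ Metric.ball (ContinuousLinearMap.id ℝ E) 1) U :=
          fun z hz => hRU (hR2 hz.1)
        exact (hX.comp contDiffOn_fst hm).prodMk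
          ((h1.comp contDiffOn_fst hm).clm_comp contDiffOn_snd))
      (x₀, ContinuousLinearMap.id ℝ E) ⟨by simp [hR], by simp⟩
    have hmem : ∀ x ∈ Metric.ball x₀ r, (x, ContinuousLinearMap.id ℝ E) ∈
        Metric.ball (x₀, ContinuousLinearMap.id ℝ E) r := by
      intro x hx
      rw [← ball_prod_same]
      exact ⟨hx, by simp [hr]⟩
    set f : E → ℝ → E := fun x t => (φ (x, ContinuousLinearMap.id ℝ E) t).1 with hf
    set A : E → ℝ → (E →L[ℝ] E) := fun x t => (φ (x, ContinuousLinearMap.id ℝ E) t).2 with hA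
    have hfd : ∀ x ∈ Metric.ball x₀ r, ∀ t ∈ Ico 0 δ, HasDerivAt (f x) (X (f x t)) t :=
      fun x hx t ht => ((hφ _ (hmem x hx)).2 t ht).2.fst
    have hAd : ∀ x ∈ Metric.ball x₀ r, ∀ t ∈ Ico 0 δ,
        HasDerivAt (A x) ((fderiv ℝ X (f x t)).comp (A x t)) t :=
      fun x hx t ht => ((hφ _ (hmem x hx)).2 t ht).2.snd
    have hfB : ∀ x ∈ Metric.ball x₀ r, ∀ t ∈ Ico 0 δ, f x t ∈ Metric.ball x₀ (R / 2) :=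
      fun x hx t ht => ((hφ _ (hmem x hx)).2 t ht).1.1
    have hA2 : ∀ x ∈ Metric.ball x₀ r, ∀ t ∈ Ico 0 δ, ‖A x t‖ ≤ 2 := by
      intro x hx t ht
      have h1 : dist (A x t) (ContinuousLinearMap.id ℝ E) < 1 :=
        ((hφ _ (hmem x hx)).2 t ht).1.2
      rw [dist_eq_norm] at h1
      have h2 : ‖A x t‖ ≤ ‖A x t - ContinuousLinearMap.id ℝ E‖ + ‖ContinuousLinearMap.id ℝ E‖ :=
        norm_le_norm_sub_add _ _
      have h3 := ContinuousLinearMap.norm_id_le (𝕜 := ℝ) (E := E)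
      linarith
    have hderiv : ∀ t ∈ Ico 0 δ, ∀ x ∈ Metric.ball x₀ r,
        HasFDerivAt (fun x => f x t) (A x t) x := by
      intro t ht x hx
      rw [hasFDerivAt_iff_isLittleO_nhds_zero]
      refine Asymptotics.IsBigO.trans_isLittleO (g := fun h : E => ‖h‖ ^ 2) ?_
        (Asymptotics.isLittleO_norm_pow_id one_lt_two)
      refine Asymptotics.IsBigO.of_bound
        (4 * C / (K + 1) * (Real.exp ((K + 1) * t) - 1)) ?_
      have hx' : ∀ᶠ h in 𝓝 (0 : E), x + h ∈ Metric.ball x₀ r := by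
        have : ContinuousAt (fun h : E => x + h) 0 := by fun_prop
        exact this.eventually_mem (by simpa using Metric.isOpen_ball.mem_nhds hx)
      have hh : ∀ᶠ h in 𝓝 (0 : E), ‖h‖ < R / 4 := by
        have := Metric.ball_mem_nhds (0 : E) (show 0 < R / 4 by linarith)
        filter_upwards [this] with h hh
        simpa using hh
      filter_upwards [hx', hh] with h h1 h2
      rw [Real.norm_of_nonneg (by positivity : (0 : ℝ) ≤ ‖h‖ ^ 2)]
      refine norm_sub_sub_le_of_linearization hC hl hq (hfd x hx) (hfd _ h1) (hAd x hx)
        (fun t ht => hR2 (hfB x hx t ht)) (fun t ht => hR2 (hfB _ h1 t ht)) (fun s hs => ?_)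
        (hA2 x hx) ?_ ht
      · have h3 := hfB x hx s hs
        have h4 : ‖A x s h‖ ≤ 2 * ‖h‖ := (A x s).le_of_opNorm_le (hA2 x hx s hs) h
        rw [Metric.mem_ball, dist_eq_norm] at h3 ⊢
        have h5 : ‖f x s + A x s h - x₀‖ ≤ ‖f x s - x₀‖ + ‖A x s h‖ := by
          rw [add_sub_right_comm]; exact norm_add_le _ _
        linarith
      · simp [hf, hA, (hφ _ (hmem x hx)).1, (hφ _ (hmem _ h1)).1]
    refine ⟨δ, hδ, r, hr, f, fun x hx => ⟨by simp [hf, (hφ _ (hmem x hx)).1],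
      fun t ht => ⟨hRU (hR2 (hfB x hx t ht)), hfd x hx t ht⟩⟩, fun t ht => ?_⟩
    push_cast
    rw [contDiffOn_succ_iff_fderiv_of_isOpen Metric.isOpen_ball]
    refine ⟨fun x hx => (hderiv t ht x hx).differentiableAt.differentiableWithinAt, by simp, ?_⟩
    have h1 : ContDiffOn ℝ k (fun x => A x t) (Metric.ball x₀ r) :=
      contDiff_snd.comp_contDiffOn ((hsm t ht).comp (by fun_prop) hmem)
    exact h1.congr fun x hx => (hderiv t ht x hx).fderiv

/-- Two solutions of the same smooth differential equation with the same initial value agree. -/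
theorem ODE_unique_of_contDiffOn {X : E → E} {U : Set E} (hU : IsOpen U)
    (hX : ContDiffOn ℝ ∞ X U) {f g : ℝ → E} {b : ℝ}
    (hf : ∀ t ∈ Icc 0 b, f t ∈ U ∧ HasDerivAt f (X (f t)) t)
    (hg : ∀ t ∈ Icc 0 b, g t ∈ U ∧ HasDerivAt g (X (g t)) t) (h0 : f 0 = g 0) :
    ∀ t ∈ Icc 0 b, f t = g t := by
  have hfc : ContinuousOn f (Icc 0 b) := fun t ht => (hf t ht).2.continuousAt.continuousWithinAt
  have hgc : ContinuousOn g (Icc 0 b) := fun t ht => (hg t ht).2.continuousAt.continuousWithinAt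
  have hcomp : IsCompact (f '' Icc 0 b ∪ g '' Icc 0 b) :=
    (isCompact_Icc.image_of_continuousOn hfc).union (isCompact_Icc.image_of_continuousOn hgc)
  have hsubU : f '' Icc 0 b ∪ g '' Icc 0 b ⊆ U := by
    rintro x (⟨t, ht, rfl⟩ | ⟨t, ht, rfl⟩)
    exacts [(hf t ht).1, (hg t ht).1]
  have hloc : LocallyLipschitzOn (f '' Icc 0 b ∪ g '' Icc 0 b) X := by
    intro x hx
    obtain ⟨K, s, hs, hl⟩ := ((hX.contDiffAt (hU.mem_nhds (hsubU hx))).of_le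
      (by exact_mod_cast le_top) : ContDiffAt ℝ 1 X x).exists_lipschitzOnWith
    exact ⟨K, s, mem_nhdsWithin_of_mem_nhds hs, hl⟩
  obtain ⟨K, hK⟩ := hloc.exists_lipschitzOnWith_of_compact hcomp
  exact ODE_solution_unique_of_mem_Icc_right (v := fun _ => X) (s := fun _ => _)
    (fun _ _ => hK) hfc (fun t ht => (hf t ⟨ht.1, ht.2.le⟩).2.hasDerivWithinAt)
    (fun t ht => Or.inl ⟨t, ⟨ht.1, ht.2.le⟩, rfl⟩) hgc
    (fun t ht => (hg t ⟨ht.1, ht.2.le⟩).2.hasDerivWithinAt)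
    (fun t ht => Or.inr ⟨t, ⟨ht.1, ht.2.le⟩, rfl⟩) h0

/-- `γ` is the complete flow of the vector field `X` on the set `U`: the curve `γ x` is the
solution with initial value `x`. -/
structure IsCompleteFlow (X : E → E) (U : Set E) (γ : E → ℝ → E) : Prop where
  zero : ∀ x ∈ U, γ x 0 = x
  mem : ∀ x ∈ U, ∀ t, γ x t ∈ U
  deriv : ∀ x ∈ U, ∀ t, HasDerivAt (γ x) (X (γ x t)) t

namespace IsCompleteFlow

variable {X : E → E} {U : Set E} {γ : E → ℝ → E}

theorem add_of_nonneg (h : IsCompleteFlow X U γ) (hU : IsOpen U) (hX : ContDiffOn ℝ ∞ X U)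
    {x : E} (hx : x ∈ U) (s : ℝ) {t : ℝ} (ht : 0 ≤ t) : γ x (s + t) = γ (γ x s) t := by
  refine ODE_unique_of_contDiffOn (b := t) (f := fun t => γ x (s + t)) hU hX
    (fun r _ => ⟨h.mem x hx _, ?_⟩) (fun r _ => ⟨h.mem _ (h.mem x hx s) r,
    h.deriv _ (h.mem x hx s) r⟩) ?_ t ⟨ht, le_rfl⟩
  · exact (h.deriv x hx (s + r)).comp_const_add s r
  · simp [h.zero _ (h.mem x hx s)]

/-- The time-`T` map of a complete smooth flow is smooth. By compactness of the orbit of `x₀` over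
`[0, T]`, there is `δ > 0` such that at each point of this orbit the time-`t` maps with `0 ≤ t < δ`
are `C^k`, and the time-`T` map is a composition of finitely many of them. -/
theorem contDiffOn_of_nonneg [CompleteSpace E] (h : IsCompleteFlow X U γ) (hU : IsOpen U)
    (hX : ContDiffOn ℝ ∞ X U) {T : ℝ} (hT : 0 ≤ T) : ContDiffOn ℝ ∞ (fun x => γ x T) U := by
  rw [contDiffOn_infty]
  intro k x₀ hx₀
  apply ContDiffAt.contDiffWithinAt
  have hloc : ∀ y ∈ U, ∃ δ > 0, ∃ V ∈ 𝓝 y, ∀ z ∈ V, ∀ t ∈ Ico 0 δ,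
      ContDiffAt ℝ k (fun x => γ x t) z := by
    intro y hy
    obtain ⟨δ, hδ, r, hr, φ, hφ, hsm⟩ := exists_local_flow_contDiffOn k E X U hU hX y hy
    obtain ⟨ρ, hρ, hρU⟩ := Metric.isOpen_iff.mp hU y hy
    refine ⟨δ, hδ, _, Metric.ball_mem_nhds y (lt_min hr hρ), fun z hz t ht => ?_⟩
    have hz1 : z ∈ Metric.ball y r := Metric.ball_subset_ball (min_le_left _ _) hz
    refine ((hsm t ht).contDiffAt (Metric.isOpen_ball.mem_nhds hz1)).congr_of_eventuallyEq ?_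
    filter_upwards [Metric.isOpen_ball.mem_nhds hz] with w hw
    have hw1 : w ∈ Metric.ball y r := Metric.ball_subset_ball (min_le_left _ _) hw
    have hw2 : w ∈ U := hρU (Metric.ball_subset_ball (min_le_right _ _) hw)
    refine ODE_unique_of_contDiffOn (b := t) hU hX
      (fun s _ => ⟨h.mem w hw2 s, h.deriv w hw2 s⟩)
      (fun s hs => (hφ w hw1).2 s ⟨hs.1, hs.2.trans_lt ht.2⟩) ?_ t ⟨ht.1, le_rfl⟩
    rw [h.zero w hw2, (hφ w hw1).1]
  have hcont : Continuous (γ x₀) := continuous_iff_continuousAt.2 fun t =>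
    (h.deriv x₀ hx₀ t).continuousAt
  have hstep : ∀ s : ℝ, ∀ t : ℝ, 0 ≤ t → ContDiffAt ℝ k (fun x => γ x s) x₀ →
      ContDiffAt ℝ k (fun x => γ x t) (γ x₀ s) → ContDiffAt ℝ k (fun x => γ x (s + t)) x₀ := by
    intro s t ht h1 h2
    refine (h2.comp x₀ h1).congr_of_eventuallyEq ?_
    filter_upwards [hU.mem_nhds hx₀] with w hw
    exact h.add_of_nonneg hU hX hw s ht
  obtain ⟨δ, hδ, hunif⟩ : ∃ δ > 0, ∀ s ∈ Icc 0 T, ∀ t ∈ Ico 0 δ,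
      ContDiffAt ℝ k (fun x => γ x t) (γ x₀ s) := by
    refine isCompact_Icc.induction_on (p := fun A : Set ℝ => ∃ δ > 0, ∀ s ∈ A, ∀ t ∈ Ico 0 δ,
      ContDiffAt ℝ k (fun x => γ x t) (γ x₀ s)) ⟨1, one_pos, by simp⟩ ?_ ?_ ?_
    · rintro A B hAB ⟨δ, hδ, h1⟩
      exact ⟨δ, hδ, fun s hs => h1 s (hAB hs)⟩
    · rintro A B ⟨δ, hδ, h1⟩ ⟨δ', hδ', h2⟩
      refine ⟨min δ δ', lt_min hδ hδ', ?_⟩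
      rintro s (hs | hs) t ht
      · exact h1 s hs t ⟨ht.1, ht.2.trans_le (min_le_left _ _)⟩
      · exact h2 s hs t ⟨ht.1, ht.2.trans_le (min_le_right _ _)⟩
    · intro s _
      obtain ⟨δ, hδ, V, hV, hsm⟩ := hloc (γ x₀ s) (h.mem x₀ hx₀ s)
      exact ⟨_, mem_nhdsWithin_of_mem_nhds (hcont.continuousAt.preimage_mem_nhds hV), δ, hδ,
        fun r hr => hsm _ hr⟩
  obtain ⟨m, hm⟩ := exists_nat_gt (T / δ)
  have hm0 : (0 : ℝ) < m := (by positivity : 0 ≤ T / δ).trans_lt hm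
  have hlt : T / m < δ := by
    rw [div_lt_iff₀ hδ] at hm
    rw [div_lt_iff₀ hm0]
    linarith
  have hind : ∀ j : ℕ, j ≤ m → ContDiffAt ℝ k (fun x => γ x (j * (T / m))) x₀ := by
    intro j
    induction j with
    | zero =>
      intro _
      refine contDiffAt_id.congr_of_eventuallyEq ?_
      filter_upwards [hU.mem_nhds hx₀] with w hw
      simp [h.zero w hw]
    | succ j ih =>
      intro hj
      have hj' : (j : ℝ) ≤ m := by exact_mod_cast (Nat.le_succ j).trans hj
      push_cast
      simp_rw [add_one_mul]
      refine hstep _ _ (by positivity) (ih ((Nat.le_succ j).trans hj))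
        (hunif _ ⟨by positivity, ?_⟩ _ ⟨by positivity, hlt⟩)
      calc (j : ℝ) * (T / m) ≤ m * (T / m) := by gcongr
        _ = T := by field_simp
  have := hind m le_rfl
  rwa [show (m : ℝ) * (T / m) = T by field_simp] at this

/-- A complete smooth flow is smooth in time and initial value together. Rescaling time turns the
time into a part of the initial value of the field `(s, x) ↦ (0, s X(x))`, whose time-one map is
`(s, x) ↦ (s, γ x s)`. -/
theorem contDiffOn_uncurry [CompleteSpace E] (h : IsCompleteFlow X U γ) (hU : IsOpen U)
    (hX : ContDiffOn ℝ ∞ X U) :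
    ContDiffOn ℝ ∞ (fun z : ℝ × E => γ z.2 z.1) (univ ×ˢ U) := by
  have h1 : IsCompleteFlow (fun z : ℝ × E => ((0 : ℝ), z.1 • X z.2))
      (univ ×ˢ U) (fun z t => (z.1, γ z.2 (z.1 * t))) := by
    refine ⟨fun z hz => by simp [h.zero z.2 hz.2], fun z hz t => ⟨trivial, h.mem _ hz.2 _⟩,
      fun z hz t => (hasDerivAt_const _ _).prodMk ?_⟩
    have := (h.deriv z.2 hz.2 (z.1 * t)).scomp t ((hasDerivAt_id t).const_mul z.1)
    simpa [Function.comp_def] using this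
  have hs := h1.contDiffOn_of_nonneg (isOpen_univ.prod hU) (contDiffOn_const.prodMk
    (contDiffOn_fst.smul (hX.comp contDiffOn_snd fun z hz => hz.2))) zero_le_one
  simpa [Function.comp_def] using contDiff_snd.comp_contDiffOn hs

end IsCompleteFlow

end SmoothFlow

/-! ### Integrals with parameters and Hadamard's lemma -/

section ParametricIntegral

variable {E F : Type u} [NormedAddCommGroup E] [NormedSpace ℝ E]
  [NormedAddCommGroup F] [NormedSpace ℝ F]

theorem hasFDerivAt_parametric_intervalIntegral {f : ℝ × E → F} {W : Set (ℝ × E)} {U : Set E}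
    {a b : ℝ} (hab : a ≤ b) (hW : IsOpen W) (hf : ContDiffOn ℝ ∞ f W) (hU : IsOpen U)
    (hWU : Icc a b ×ˢ U ⊆ W) {x₀ : E} (hx₀ : x₀ ∈ U) :
    HasFDerivAt (fun x => ∫ s in a..b, f (s, x))
      (∫ s in a..b, (fderiv ℝ f (s, x₀)).comp (ContinuousLinearMap.inr ℝ ℝ E)) x₀ := by
  set g : ℝ × E → (E →L[ℝ] F) := fun z => (fderiv ℝ f z).comp (ContinuousLinearMap.inr ℝ ℝ E)
  have hdf : ContDiffOn ℝ ∞ (fderiv ℝ f) W := hf.fderiv_of_isOpen hW (by simp)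
  have hg : ContinuousOn g W := (hdf.clm_comp contDiffOn_const).continuousOn
  have hslice : ∀ x : E, x ∈ U → MapsTo (fun s : ℝ => (s, x)) (Icc a b) W :=
    fun x hx s hs => hWU ⟨hs, hx⟩
  have hsl : ∀ x : E, ContinuousOn (fun s : ℝ => (s, x)) (Icc a b) := fun x => by fun_prop
  obtain ⟨C, hC⟩ := (isCompact_Icc (a := a) (b := b)).exists_bound_of_continuousOn
    (hg.comp (hsl x₀) (hslice x₀ hx₀))
  have hopen : IsOpen (W ∩ (fun z => ‖g z‖) ⁻¹' Iio (C + 1)) :=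
    hg.norm.isOpen_inter_preimage hW isOpen_Iio
  obtain ⟨u, v, hu, hv, hIu, hxv, huv⟩ := generalized_tube_lemma (isCompact_Icc (a := a) (b := b))
    (isCompact_singleton (x := x₀)) hopen (by
      rintro ⟨s, x⟩ ⟨hs, rfl⟩
      exact ⟨hWU ⟨hs, hx₀⟩, (hC s hs).trans_lt (lt_add_one C)⟩)
  have huI : uIoc a b ⊆ Icc a b := by
    rw [uIoc_of_le hab]; exact Ioc_subset_Icc_self
  refine intervalIntegral.hasFDerivAt_integral_of_dominated_of_fderiv_le
    (F := fun x s => f (s, x)) (F' := fun x s => g (s, x)) (s := v) (bound := fun _ => C + 1)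
    (hv.mem_nhds (hxv rfl)) ?_ ?_ ?_ ?_ ?_ ?_
  · filter_upwards [hU.mem_nhds hx₀] with x hx
    exact ((hf.continuousOn.comp (hsl x) (hslice x hx)).mono huI).aestronglyMeasurable
      measurableSet_uIoc
  · exact (hf.continuousOn.comp (hsl x₀) (hslice x₀ hx₀)).intervalIntegrable_of_Icc hab
  · exact ((hg.comp (hsl x₀) (hslice x₀ hx₀)).mono huI).aestronglyMeasurable measurableSet_uIoc
  · exact Eventually.of_forall fun s hs x hx =>
      (huv (⟨hIu (huI hs), hx⟩ : (s, x) ∈ u ×ˢ v)).2.le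
  · exact intervalIntegrable_const
  · refine Eventually.of_forall fun s hs x hx => ?_
    have hz : (s, x) ∈ W := (huv (⟨hIu (huI hs), hx⟩ : (s, x) ∈ u ×ˢ v)).1
    have h1 : HasFDerivAt f (fderiv ℝ f (s, x)) (s, x) :=
      ((hf.contDiffAt (hW.mem_nhds hz)).differentiableAt (by simp)).hasFDerivAt
    exact h1.comp x (hasFDerivAt_prodMk_right s x)

/-- The integral over a compact interval of a function that depends smoothly on a parameter is a
smooth function of the parameter. -/
theorem contDiffOn_parametric_intervalIntegral {W : Set (ℝ × E)} {U : Set E}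
    {a b : ℝ} (hab : a ≤ b) (hW : IsOpen W) (hU : IsOpen U) (hWU : Icc a b ×ˢ U ⊆ W)
    {f : ℝ × E → F} (hf : ContDiffOn ℝ ∞ f W) :
    ContDiffOn ℝ ∞ (fun x => ∫ s in a..b, f (s, x)) U := by
  rw [contDiffOn_infty]
  intro k
  induction k generalizing F with
  | zero =>
    rw [Nat.cast_zero, contDiffOn_zero]
    exact fun x hx => (hasFDerivAt_parametric_intervalIntegral hab hW hf hU hWU
      hx).continuousAt.continuousWithinAt
  | succ k ih =>
    push_cast
    rw [contDiffOn_succ_iff_fderiv_of_isOpen hU]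
    refine ⟨fun x hx => (hasFDerivAt_parametric_intervalIntegral hab hW hf hU hWU
      hx).differentiableAt.differentiableWithinAt, by simp, ?_⟩
    have hdf : ContDiffOn ℝ ∞ (fderiv ℝ f) W := hf.fderiv_of_isOpen hW (by simp)
    refine (ih (f := fun z => (fderiv ℝ f z).comp (ContinuousLinearMap.inr ℝ ℝ E))
      (hdf.clm_comp contDiffOn_const)).congr fun x hx => ?_
    exact (hasFDerivAt_parametric_intervalIntegral hab hW hf hU hWU hx).fderiv

/-- **Hadamard's lemma** with parameters: a smooth function `f (t, x)` is
`f (0, x) + t g (t, x)` with `g` smooth, namely `g (t, x) = ∫₀¹ ∂ₜf (θ t, x) dθ`. -/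
theorem exists_hadamard_quotient [CompleteSpace F] {ε : ℝ} (hε : 0 < ε) {U : Set E} (hU : IsOpen U)
    {f : ℝ × E → F} (hf : ContDiffOn ℝ ∞ f (Ioo (-ε) ε ×ˢ U)) :
    ∃ g : ℝ × E → F, ContDiffOn ℝ ∞ g (Ioo (-ε) ε ×ˢ U) ∧
      (∀ t ∈ Ioo (-ε) ε, ∀ x ∈ U, f (t, x) = f (0, x) + t • g (t, x)) ∧
      ∀ x ∈ U, g (0, x) = deriv (fun t => f (t, x)) 0 := by
  have hO : IsOpen (Ioo (-ε) ε ×ˢ U) := isOpen_Ioo.prod hU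
  set h : ℝ × E → F := fun z => fderiv ℝ f z (1, 0) with hh
  have hhs : ContDiffOn ℝ ∞ h (Ioo (-ε) ε ×ˢ U) :=
    (hf.fderiv_of_isOpen hO (by simp)).clm_apply contDiffOn_const
  have hmul : ∀ t ∈ Ioo (-ε) ε, ∀ θ ∈ Icc (0 : ℝ) 1, θ * t ∈ Ioo (-ε) ε := by
    intro t ht θ hθ
    rw [mem_Ioo, ← abs_lt] at ht ⊢
    rw [abs_mul, abs_of_nonneg hθ.1]
    exact (mul_le_of_le_one_left (abs_nonneg t) hθ.2).trans_lt ht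
  have hder : ∀ t ∈ Ioo (-ε) ε, ∀ x ∈ U, HasDerivAt (fun t => f (t, x)) (h (t, x)) t := by
    intro t ht x hx
    have h1 : HasFDerivAt f (fderiv ℝ f (t, x)) (t, x) :=
      ((hf.contDiffAt (hO.mem_nhds ⟨ht, hx⟩)).differentiableAt (by simp)).hasFDerivAt
    exact h1.comp_hasDerivAt t ((hasDerivAt_id t).prodMk (hasDerivAt_const t x))
  have hcont : Continuous fun z : ℝ × (ℝ × E) => (z.1 * z.2.1, z.2.2) := by fun_prop
  set W : Set (ℝ × (ℝ × E)) := (fun z : ℝ × (ℝ × E) => (z.1 * z.2.1, z.2.2)) ⁻¹'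
    (Ioo (-ε) ε ×ˢ U) with hWdef
  have hc2 : ContDiffOn ℝ ∞ (fun z : ℝ × (ℝ × E) => h (z.1 * z.2.1, z.2.2)) W :=
    hhs.comp (ContDiff.contDiffOn (by fun_prop)) fun z hz => hz
  refine ⟨fun z => ∫ θ in (0 : ℝ)..1, h (θ * z.1, z.2), ?_, ?_, ?_⟩
  · exact contDiffOn_parametric_intervalIntegral
      (f := fun z : ℝ × (ℝ × E) => h (z.1 * z.2.1, z.2.2)) zero_le_one
      (hO.preimage hcont) hO (fun z hz => ⟨hmul _ hz.2.1 _ hz.1, hz.2.2⟩) hc2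
  · intro t ht x hx
    have hderiv : ∀ θ ∈ uIcc (0 : ℝ) 1,
        HasDerivAt (fun θ => f (θ * t, x)) (t • h (θ * t, x)) θ := by
      intro θ hθ
      rw [uIcc_of_le zero_le_one] at hθ
      have := (hder _ (hmul t ht θ hθ) x hx).scomp θ ((hasDerivAt_id θ).mul_const t)
      simpa [Function.comp_def] using this
    have hco : ContinuousOn (fun θ => t • h (θ * t, x)) (Icc 0 1) :=
      (hhs.continuousOn.comp (by fun_prop) fun θ hθ => ⟨hmul t ht θ hθ, hx⟩).const_smul t
    have := intervalIntegral.integral_eq_sub_of_hasDerivAt hderiv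
      (hco.intervalIntegrable_of_Icc zero_le_one)
    rw [intervalIntegral.integral_smul] at this
    simp only [one_mul, zero_mul] at this
    rw [this]
    abel
  · intro x hx
    simp [(hder 0 ⟨by linarith, hε⟩ x hx).deriv]

end ParametricIntegral

/-! ### Symplectic algebra and Hamiltonians homogeneous of degree two -/

variable {n : ℕ}

section SymplecticAlgebra

/-- The complex structure `J` of phase space that represents `dα` by the inner product:
`dα(u, v) = ⟪J u, v⟫`. -/
noncomputable def rotation : PhaseSpace n →L[ℝ] PhaseSpace n :=
  LinearMap.toContinuousLinearMap
    { toFun := fun u => WithLp.toLp 2 (Sum.elim (fun i => u (Sum.inr i)) fun i => -u (Sum.inl i))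
      map_add' := fun u v => by
        ext (i | i) <;> simp [add_comm]
      map_smul' := fun c u => by
        ext (i | i) <;> simp }

@[simp] theorem rotation_inl (u : PhaseSpace n) (i : Fin n) :
    rotation u (Sum.inl i) = u (Sum.inr i) := rfl

@[simp] theorem rotation_inr (u : PhaseSpace n) (i : Fin n) :
    rotation u (Sum.inr i) = -u (Sum.inl i) := rfl

@[simp] theorem rotation_rotation (u : PhaseSpace n) : rotation (rotation u) = -u := by
  ext (i | i) <;> simp

theorem inner_rotation (u v : PhaseSpace n) :
    inner ℝ (rotation u) v =
      ∑ i : Fin n, (u (Sum.inr i) * v (Sum.inl i) - u (Sum.inl i) * v (Sum.inr i)) := by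
  rw [PiLp.inner_apply, Fintype.sum_sum_type, ← Finset.sum_add_distrib]
  refine Finset.sum_congr rfl fun i _ => ?_
  simp
  ring

theorem inner_rotation_swap (u v : PhaseSpace n) :
    inner ℝ (rotation u) v = -inner ℝ (rotation v) u := by
  rw [inner_rotation, inner_rotation, ← Finset.sum_neg_distrib]
  exact Finset.sum_congr rfl fun i _ => by ring

@[simp] theorem inner_rotation_self (u : PhaseSpace n) : inner ℝ (rotation u) u = 0 := by
  have := inner_rotation_swap u u
  linarith

theorem liouville_eq_inner (x v : PhaseSpace n) :
    liouville x v = 1 / 2 * inner ℝ (rotation x) v := by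
  rw [inner_rotation, liouville]

theorem dLiouville_eq_inner (x u v : PhaseSpace n) : dLiouville x u v = inner ℝ (rotation u) v := by
  have h : ∀ v u : PhaseSpace n, fderiv ℝ (fun y => liouville y v) x u
      = 1 / 2 * inner ℝ (rotation u) v := by
    intro v u
    have h1 : HasFDerivAt (fun y : PhaseSpace n => liouville y v)
        ((1 / 2 : ℝ) • (innerSL ℝ v).comp (rotation : PhaseSpace n →L[ℝ] PhaseSpace n)) x := by
      have h2 : (fun y : PhaseSpace n => liouville y v) =
          ((1 / 2 : ℝ) • (innerSL ℝ v).comp (rotation : PhaseSpace n →L[ℝ] PhaseSpace n)) := by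
        ext y
        simp [liouville_eq_inner, real_inner_comm]
      rw [h2]
      exact ((1 / 2 : ℝ) • (innerSL ℝ v).comp
        (rotation : PhaseSpace n →L[ℝ] PhaseSpace n)).hasFDerivAt
    rw [h1.fderiv]
    simp [real_inner_comm]
  rw [dLiouville, h, h, inner_rotation_swap v u]
  ring

/-- The Hamiltonian vector field `J ∇H`, that is, `q' = ∂H/∂p`, `p' = -∂H/∂q`. -/
noncomputable def hamField (H : PhaseSpace n → ℝ) (x : PhaseSpace n) : PhaseSpace n :=
  rotation ((InnerProductSpace.toDual ℝ (PhaseSpace n)).symm (fderiv ℝ H x))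

theorem inner_rotation_hamField (H : PhaseSpace n → ℝ) (x v : PhaseSpace n) :
    inner ℝ (rotation (hamField H x)) v = -fderiv ℝ H x v := by
  rw [hamField, rotation_rotation, inner_neg_left, InnerProductSpace.toDual_symm_apply]

theorem eq_hamField_iff {H : PhaseSpace n → ℝ} {x X : PhaseSpace n} :
    X = hamField H x ↔ ∀ v, inner ℝ (rotation X) v = -fderiv ℝ H x v := by
  refine ⟨fun h v => h ▸ inner_rotation_hamField H x v, fun h => ?_⟩
  have h1 : rotation X = rotation (hamField H x) := ext_inner_right ℝ fun v => by
    rw [h, inner_rotation_hamField]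
  have h2 := congrArg (fun u => -rotation u) h1
  simpa using h2

/-- The Poisson bracket is skew-symmetric. -/
theorem fderiv_hamField_swap (F G : PhaseSpace n → ℝ) (x : PhaseSpace n) :
    fderiv ℝ F x (hamField G x) = -fderiv ℝ G x (hamField F x) := by
  have h1 := inner_rotation_hamField F x (hamField G x)
  have h2 := inner_rotation_hamField G x (hamField F x)
  have h3 := inner_rotation_swap (hamField F x) (hamField G x)
  linarith

end SymplecticAlgebra

section Homogeneous

theorem isOpen_compl_zero : IsOpen ({0}ᶜ : Set (PhaseSpace n)) := isOpen_compl_singleton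

namespace IsHomogeneousSmooth

variable {F : PhaseSpace n → ℝ}

theorem map_zero (hF : IsHomogeneousSmooth F) : F 0 = 0 := by
  have := hF.homogeneous 2 two_pos 0
  rw [smul_zero] at this
  linarith

theorem contDiffAt (hF : IsHomogeneousSmooth F) {x : PhaseSpace n} (hx : x ≠ 0) :
    ContDiffAt ℝ ∞ F x := hF.smooth.contDiffAt (isOpen_compl_zero.mem_nhds hx)

theorem hasFDerivAt (hF : IsHomogeneousSmooth F) {x : PhaseSpace n} (hx : x ≠ 0) :
    HasFDerivAt F (fderiv ℝ F x) x := ((hF.contDiffAt hx).differentiableAt (by simp)).hasFDerivAt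

theorem fderiv_smul (hF : IsHomogeneousSmooth F) {c : ℝ} (hc : 0 < c) (x : PhaseSpace n) :
    fderiv ℝ F (c • x) = c • fderiv ℝ F x := by
  have h1 : fderiv ℝ (fun y => F (c • y)) x = c • fderiv ℝ F (c • x) := fderiv_comp_smul c
  have h2 : (fun y => F (c • y)) = fun y => c ^ 2 • F y := by
    ext y; rw [hF.homogeneous c hc, smul_eq_mul]
  have h3 : fderiv ℝ (fun y => c ^ 2 • F y) x = c ^ 2 • fderiv ℝ F x :=
    congrFun (fderiv_const_smul_field (f := F) (c ^ 2)) x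
  rw [h2, h3, pow_two, mul_smul] at h1
  exact (smul_right_injective _ hc.ne' h1).symm

/-- **Euler's identity** for homogeneous functions of degree `2`. -/
theorem fderiv_self (hF : IsHomogeneousSmooth F) {x : PhaseSpace n} (hx : x ≠ 0) :
    fderiv ℝ F x x = 2 * F x := by
  have h1 : HasDerivAt (fun c : ℝ => F (c • x)) (fderiv ℝ F x x) 1 := by
    have h2 : HasDerivAt (fun c : ℝ => c • x) x 1 := by
      simpa using (hasDerivAt_id (1 : ℝ)).smul_const x
    have h3 : HasFDerivAt F (fderiv ℝ F x) ((1 : ℝ) • x) := by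
      rw [one_smul]; exact hF.hasFDerivAt hx
    exact h3.comp_hasDerivAt (1 : ℝ) h2
  have h4 : HasDerivAt (fun c : ℝ => c ^ 2 * F x) (2 * F x) 1 := by
    simpa using (hasDerivAt_pow 2 (1 : ℝ)).mul_const (F x)
  refine h1.unique (h4.congr_of_eventuallyEq ?_)
  filter_upwards [lt_mem_nhds (zero_lt_one (α := ℝ))] with c hc
  exact hF.homogeneous c hc x

theorem hamField_smul (hF : IsHomogeneousSmooth F) {c : ℝ} (hc : 0 < c) (x : PhaseSpace n) :
    hamField F (c • x) = c • hamField F x := by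
  simp [hamField, hF.fderiv_smul hc]

theorem contDiffOn_hamField (hF : IsHomogeneousSmooth F) :
    ContDiffOn ℝ ∞ (hamField F) {0}ᶜ := by
  have h1 : ContDiffOn ℝ ∞ (fderiv ℝ F) {0}ᶜ :=
    hF.smooth.fderiv_of_isOpen isOpen_compl_zero (by simp)
  exact rotation.contDiff.comp_contDiffOn
    ((InnerProductSpace.toDual ℝ (PhaseSpace n)).symm.contDiff.comp_contDiffOn h1)

/-- The Reeb field of `{F = 1}` is the restriction of the Hamiltonian field of `F`. -/
theorem isReebVector_iff (hF : IsHomogeneousSmooth F) {x X : PhaseSpace n} (hx : F x = 1) :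
    IsReebVector F x X ↔ X = hamField F x := by
  have hx0 : x ≠ 0 := by
    rintro rfl
    rw [hF.map_zero] at hx
    exact zero_ne_one hx
  have heuler : fderiv ℝ F x x = 2 := by rw [hF.fderiv_self hx0, hx]; norm_num
  constructor
  · rintro ⟨h1, h2, h3⟩
    rw [eq_hamField_iff]
    rw [liouville_eq_inner, inner_rotation_swap] at h3
    -- `v` is the sum of a tangent vector and a multiple of the radial vector `x`.
    intro v
    have h4 := h2 (v - (fderiv ℝ F x v / 2) • x) (by simp [heuler])
    rw [dLiouville_eq_inner, inner_sub_right, inner_smul_right] at h4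
    have h5 : inner ℝ (rotation X) x = -2 := by linarith
    rw [h5] at h4
    linarith
  · intro h
    rw [eq_hamField_iff] at h
    refine ⟨?_, fun v hv => ?_, ?_⟩
    · have := h X
      rw [inner_rotation_self] at this
      linarith
    · rw [dLiouville_eq_inner, h, hv, neg_zero]
    · rw [liouville_eq_inner, inner_rotation_swap, h, heuler]
      norm_num

end IsHomogeneousSmooth

theorem isCharacteristic_iff {F : PhaseSpace n → ℝ} (hF : IsHomogeneousSmooth F)
    {γ : ℝ → PhaseSpace n} :
    IsCharacteristic F γ ↔ (∀ t, F (γ t) = 1) ∧ ∀ t, HasDerivAt γ (hamField F (γ t)) t := by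
  constructor
  · rintro ⟨h1, h2, h3⟩
    refine ⟨h1, fun t => ?_⟩
    rw [← (hF.isReebVector_iff (h1 t)).1 (h3 t)]
    exact (h2 t).hasDerivAt
  · rintro ⟨h1, h2⟩
    refine ⟨h1, fun t => (h2 t).differentiableAt, fun t => ?_⟩
    rw [(h2 t).deriv]
    exact (hF.isReebVector_iff (h1 t)).2 rfl

theorem action_eq {F : PhaseSpace n → ℝ} {γ : ℝ → PhaseSpace n} (h : IsCharacteristic F γ)
    (T : ℝ) : action γ T = T := by
  simp [action, (h.reeb _).normalized]

theorem IsStarHamiltonian.pos {H : PhaseSpace n → ℝ} (hH : IsStarHamiltonian H)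
    {x : PhaseSpace n} (hx : x ≠ 0) : 0 < H x := by
  refine lt_of_le_of_ne (hH.nonneg x) fun h => ?_
  have h1 : Tendsto (fun c : ℝ => c • x) atTop (cocompact (PhaseSpace n)) := by
    rw [← Metric.cobounded_eq_cocompact, ← tendsto_norm_atTop_iff_cobounded]
    simp_rw [norm_smul]
    exact tendsto_norm_atTop_atTop.atTop_mul_const (norm_pos_iff.2 hx)
  have h2 := hH.proper.comp h1
  have h3 : Tendsto (fun _ : ℝ => (0 : ℝ)) atTop atTop := by
    refine h2.congr' ?_
    filter_upwards [eventually_gt_atTop 0] with c hc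
    simp [hH.homogeneous c hc, ← h]
  exact not_tendsto_const_atTop _ _ h3

/-- Homogeneity reduces estimates to the unit sphere. -/
theorem norm_smul_normalize {x : PhaseSpace n} (hx : x ≠ 0) :
    ∃ u ∈ Metric.sphere (0 : PhaseSpace n) 1, ‖x‖ • u = x :=
  ⟨‖x‖⁻¹ • x, by simp [norm_smul, hx], by simp [smul_smul, hx]⟩

theorem sphere_subset_compl_zero : Metric.sphere (0 : PhaseSpace n) 1 ⊆ {0}ᶜ := by
  rintro x hx rfl
  simp at hx

/-- A positive homogeneous function, smooth outside the origin, is proper. -/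
theorem IsHomogeneousSmooth.isStarHamiltonian {H : PhaseSpace n → ℝ} (hH : IsHomogeneousSmooth H)
    (hpos : ∀ x ∈ Metric.sphere (0 : PhaseSpace n) 1, 0 < H x) : IsStarHamiltonian H := by
  obtain ⟨c, hc, hcH⟩ : ∃ c > 0, ∀ x ∈ Metric.sphere (0 : PhaseSpace n) 1, c ≤ H x := by
    rcases (Metric.sphere (0 : PhaseSpace n) 1).eq_empty_or_nonempty with h | h
    · exact ⟨1, one_pos, by simp [h]⟩
    · obtain ⟨x, hx, hmin⟩ := (isCompact_sphere (0 : PhaseSpace n) 1).exists_isMinOn h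
        (hH.smooth.continuousOn.mono sphere_subset_compl_zero)
      exact ⟨H x, hpos x hx, fun y hy => hmin hy⟩
  have hbound : ∀ x, c * ‖x‖ ^ 2 ≤ H x := by
    intro x
    rcases eq_or_ne x 0 with rfl | hx
    · simp [hH.map_zero]
    · obtain ⟨u, hu, hux⟩ := norm_smul_normalize hx
      conv_rhs => rw [← hux]
      rw [hH.homogeneous _ (norm_pos_iff.2 hx), mul_comm]
      exact mul_le_mul_of_nonneg_left (hcH u hu) (by positivity)
  refine ⟨hH, fun x => le_trans (by positivity) (hbound x), ?_⟩
  refine tendsto_atTop_mono hbound (Tendsto.const_mul_atTop hc ?_)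
  exact (tendsto_pow_atTop two_ne_zero).comp (tendsto_norm_cocompact_atTop (E := PhaseSpace n))

/-- A map that is smooth outside the origin and homogeneous of degree `1` is Lipschitz, because its
derivative is homogeneous of degree `0`. -/
theorem exists_lipschitz_of_homogeneous {G : PhaseSpace n → PhaseSpace n}
    (hG : ContDiffOn ℝ ∞ G {0}ᶜ) (hhom : ∀ c : ℝ, 0 < c → ∀ x, G (c • x) = c • G x) :
    ∃ L : ℝ, 0 ≤ L ∧ (∀ x y, ‖G x - G y‖ ≤ L * ‖x - y‖) ∧ ∀ x ≠ 0, ‖fderiv ℝ G x‖ ≤ L := by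
  have hdG : ContDiffOn ℝ ∞ (fderiv ℝ G) {0}ᶜ := hG.fderiv_of_isOpen isOpen_compl_zero (by simp)
  have hS := isCompact_sphere (0 : PhaseSpace n) 1
  obtain ⟨A, hA⟩ := hS.exists_bound_of_continuousOn
    (hG.continuousOn.mono sphere_subset_compl_zero)
  obtain ⟨B, hB⟩ := hS.exists_bound_of_continuousOn
    (hdG.continuousOn.mono sphere_subset_compl_zero)
  have h0 : G 0 = 0 := by
    have := hhom 2 two_pos 0
    rw [smul_zero, two_smul] at this
    simpa using this
  have hGx : ∀ x, ‖G x‖ ≤ max (max A B) 0 * ‖x‖ := by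
    intro x
    rcases eq_or_ne x 0 with rfl | hx
    · simp [h0]
    · obtain ⟨u, hu, hux⟩ := norm_smul_normalize hx
      conv_lhs => rw [← hux]
      rw [hhom _ (norm_pos_iff.2 hx), norm_smul, norm_norm, mul_comm]
      gcongr
      exact (hA u hu).trans ((le_max_left _ _).trans (le_max_left _ _))
  have hdGx : ∀ x ≠ 0, ‖fderiv ℝ G x‖ ≤ max (max A B) 0 := by
    intro x hx
    obtain ⟨u, hu, hux⟩ := norm_smul_normalize hx
    have hc := norm_pos_iff.2 hx
    have h1 : fderiv ℝ (fun y => G (‖x‖ • y)) u = ‖x‖ • fderiv ℝ G (‖x‖ • u) := fderiv_comp_smul _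
    have h2 : (fun y => G (‖x‖ • y)) = fun y => ‖x‖ • G y := by
      ext1 y; rw [hhom _ hc]
    have h3 : fderiv ℝ (fun y => ‖x‖ • G y) u = ‖x‖ • fderiv ℝ G u :=
      congrFun (fderiv_const_smul_field (f := G) ‖x‖) u
    rw [h2, h3] at h1
    have h4 : fderiv ℝ G u = fderiv ℝ G (‖x‖ • u) := smul_right_injective _ hc.ne' h1
    rw [hux] at h4
    rw [← h4]
    exact (hB u hu).trans ((le_max_right _ _).trans (le_max_left _ _))
  refine ⟨_, le_max_right _ _, fun x y => ?_, hdGx⟩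
  -- On a segment through the origin, where `G` need not be differentiable, `‖x - y‖ = ‖x‖ + ‖y‖`.
  by_cases hseg : (0 : PhaseSpace n) ∈ segment ℝ x y
  · have h1 := dist_add_dist_of_mem_segment hseg
    rw [dist_zero_right, dist_zero_left, dist_eq_norm] at h1
    calc ‖G x - G y‖ ≤ ‖G x‖ + ‖G y‖ := norm_sub_le _ _
      _ ≤ max (max A B) 0 * ‖x‖ + max (max A B) 0 * ‖y‖ := add_le_add (hGx x) (hGx y)
      _ = max (max A B) 0 * ‖x - y‖ := by rw [← h1]; ring
  · refine (convex_segment x y).norm_image_sub_le_of_norm_hasFDerivWithin_le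
      (f' := fderiv ℝ G) (fun z hz => ?_) (fun z hz => ?_) (right_mem_segment ℝ x y)
      (left_mem_segment ℝ x y)
    · have hz0 : z ≠ 0 := fun h => hseg (h ▸ hz)
      exact ((hG.contDiffAt (isOpen_compl_zero.mem_nhds hz0)).differentiableAt
        (by simp)).hasFDerivAt.hasFDerivWithinAt
    · exact hdGx z fun h => hseg (h ▸ hz)

end Homogeneous

/-! ### Symplectic families and Cayley transforms -/

/-- A local left inverse of a smooth map with injective derivative, between spaces of the same
dimension, is smooth. -/
theorem contDiffAt_of_eventually_leftInverse {E : Type*} [NormedAddCommGroup E] [NormedSpace ℝ E]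
    [FiniteDimensional ℝ E] {f g : E → E} {a : E} (hf : ContDiffAt ℝ ∞ f a)
    (hinj : ∀ v, fderiv ℝ f a v = 0 → v = 0) (hg : ∀ᶠ x in 𝓝 a, g (f x) = x) :
    ContDiffAt ℝ ∞ g (f a) := by
  have : CompleteSpace E := FiniteDimensional.complete ℝ E
  set e : E ≃L[ℝ] E := (LinearEquiv.ofInjectiveEndo (fderiv ℝ f a : E →ₗ[ℝ] E)
    ((injective_iff_map_eq_zero _).2 hinj)).toContinuousLinearEquiv with he
  have he' : (e : E →L[ℝ] E) = fderiv ℝ f a := by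
    ext v
    rfl
  have hfd : HasFDerivAt f (e : E →L[ℝ] E) a := by
    rw [he']; exact (hf.differentiableAt (by simp)).hasFDerivAt
  have hst := hf.hasStrictFDerivAt' hfd (by simp)
  exact (hf.to_localInverse hfd (by simp)).congr_of_eventuallyEq (hst.localInverse_unique hg)

/-- A smooth family `Ψ t`, `|t| < ε`, of symplectic diffeomorphisms of the complement of the
origin, homogeneous of degree `1`, that starts at the identity; `Ψi t` is the inverse of `Ψ t`. -/
structure IsSymplecticFamily (ε : ℝ) (Ψ Ψi : ℝ → PhaseSpace n → PhaseSpace n) : Prop where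
  smooth : ContDiffOn ℝ ∞ (fun z : ℝ × PhaseSpace n => Ψ z.1 z.2) (Ioo (-ε) ε ×ˢ {0}ᶜ)
  smooth_inv : ContDiffOn ℝ ∞ (fun z : ℝ × PhaseSpace n => Ψi z.1 z.2) (Ioo (-ε) ε ×ˢ {0}ᶜ)
  homogeneous : ∀ t ∈ Ioo (-ε) ε, ∀ c : ℝ, 0 < c → ∀ x, Ψ t (c • x) = c • Ψ t x
  left_inv : ∀ t ∈ Ioo (-ε) ε, ∀ x, Ψi t (Ψ t x) = x
  right_inv : ∀ t ∈ Ioo (-ε) ε, ∀ x, Ψ t (Ψi t x) = x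
  zero_apply : ∀ x, Ψ 0 x = x
  symplectic : ∀ t ∈ Ioo (-ε) ε, ∀ x ≠ 0, ∀ u v,
    inner ℝ (rotation (fderiv ℝ (Ψ t) x u)) (fderiv ℝ (Ψ t) x v) = inner ℝ (rotation u) v

theorem isOpen_Ioo_prod_compl_zero (ε : ℝ) :
    IsOpen (Ioo (-ε) ε ×ˢ ({0}ᶜ : Set (PhaseSpace n))) :=
  isOpen_Ioo.prod isOpen_compl_zero

/-- The members of a jointly smooth family are smooth. -/
theorem contDiffOn_slice {F : Type*} [NormedAddCommGroup F] [NormedSpace ℝ F] {ε : ℝ}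
    {f : ℝ → PhaseSpace n → F}
    (hf : ContDiffOn ℝ ∞ (fun z : ℝ × PhaseSpace n => f z.1 z.2) (Ioo (-ε) ε ×ˢ {0}ᶜ)) {t : ℝ}
    (ht : t ∈ Ioo (-ε) ε) : ContDiffOn ℝ ∞ (f t) {0}ᶜ :=
  hf.comp (f := fun x => (t, x)) (by fun_prop) fun _ hx => ⟨ht, hx⟩

namespace IsSymplecticFamily

variable {ε : ℝ} {Ψ Ψi : ℝ → PhaseSpace n → PhaseSpace n} {t : ℝ}

theorem map_zero (h : IsSymplecticFamily ε Ψ Ψi) (ht : t ∈ Ioo (-ε) ε) : Ψ t 0 = 0 := by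
  have := h.homogeneous t ht 2 two_pos 0
  rw [smul_zero, two_smul] at this
  simpa using this

theorem inv_map_zero (h : IsSymplecticFamily ε Ψ Ψi) (ht : t ∈ Ioo (-ε) ε) : Ψi t 0 = 0 := by
  simpa [h.map_zero ht] using h.left_inv t ht 0

theorem ne_zero (h : IsSymplecticFamily ε Ψ Ψi) (ht : t ∈ Ioo (-ε) ε) {x : PhaseSpace n}
    (hx : x ≠ 0) : Ψ t x ≠ 0 := fun h0 => hx <| by
  rw [← h.left_inv t ht x, h0, h.inv_map_zero ht]

theorem inv_ne_zero (h : IsSymplecticFamily ε Ψ Ψi) (ht : t ∈ Ioo (-ε) ε) {x : PhaseSpace n}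
    (hx : x ≠ 0) : Ψi t x ≠ 0 := fun h0 => hx <| by
  rw [← h.right_inv t ht x, h0, h.map_zero ht]

theorem inv_homogeneous (h : IsSymplecticFamily ε Ψ Ψi) (ht : t ∈ Ioo (-ε) ε) {c : ℝ}
    (hc : 0 < c) (x : PhaseSpace n) : Ψi t (c • x) = c • Ψi t x := by
  rw [← h.left_inv t ht (c • Ψi t x), h.homogeneous t ht c hc, h.right_inv t ht]

theorem zero_inv_apply (h : IsSymplecticFamily ε Ψ Ψi) (hε : 0 < ε) (x : PhaseSpace n) :
    Ψi 0 x = x := by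
  have := h.left_inv 0 ⟨by linarith, hε⟩ x
  rwa [h.zero_apply] at this

theorem hasFDerivAt (h : IsSymplecticFamily ε Ψ Ψi) (ht : t ∈ Ioo (-ε) ε) {x : PhaseSpace n}
    (hx : x ≠ 0) : HasFDerivAt (Ψ t) (fderiv ℝ (Ψ t) x) x :=
  (((contDiffOn_slice h.smooth ht).contDiffAt
    (isOpen_compl_zero.mem_nhds hx)).differentiableAt (by simp)).hasFDerivAt

theorem refl : IsSymplecticFamily ε (fun _ x => x) (fun _ (x : PhaseSpace n) => x) where
  smooth := contDiffOn_snd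
  smooth_inv := contDiffOn_snd
  homogeneous _ _ _ _ _ := rfl
  left_inv _ _ _ := rfl
  right_inv _ _ _ := rfl
  zero_apply _ := rfl
  symplectic t _ x _ u v := by simp [fderiv_fun_id]

/-- Change of the parameter of a family. -/
theorem reparam (h : IsSymplecticFamily ε Ψ Ψi) {τ : ℝ → ℝ} {ε' : ℝ} (hτ : ContDiff ℝ ∞ τ)
    (hτ0 : τ 0 = 0) (hm : ∀ t ∈ Ioo (-ε') ε', τ t ∈ Ioo (-ε) ε) :
    IsSymplecticFamily ε' (fun t => Ψ (τ t)) (fun t => Ψi (τ t)) where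
  smooth := h.smooth.comp (f := fun z : ℝ × PhaseSpace n => (τ z.1, z.2))
    (ContDiff.contDiffOn (by fun_prop)) fun z hz => ⟨hm _ hz.1, hz.2⟩
  smooth_inv := h.smooth_inv.comp (f := fun z : ℝ × PhaseSpace n => (τ z.1, z.2))
    (ContDiff.contDiffOn (by fun_prop)) fun z hz => ⟨hm _ hz.1, hz.2⟩
  homogeneous t ht := h.homogeneous _ (hm t ht)
  left_inv t ht := h.left_inv _ (hm t ht)
  right_inv t ht := h.right_inv _ (hm t ht)
  zero_apply x := by rw [hτ0, h.zero_apply]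
  symplectic t ht := h.symplectic _ (hm t ht)

theorem comp (h : IsSymplecticFamily ε Ψ Ψi) {Θ Θi : ℝ → PhaseSpace n → PhaseSpace n}
    (h' : IsSymplecticFamily ε Θ Θi) :
    IsSymplecticFamily ε (fun t x => Ψ t (Θ t x)) (fun t x => Θi t (Ψi t x)) where
  smooth := h.smooth.comp (f := fun z : ℝ × PhaseSpace n => (z.1, Θ z.1 z.2))
    (contDiffOn_fst.prodMk h'.smooth) fun z hz => ⟨hz.1, h'.ne_zero hz.1 hz.2⟩
  smooth_inv := h'.smooth_inv.comp (f := fun z : ℝ × PhaseSpace n => (z.1, Ψi z.1 z.2))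
    (contDiffOn_fst.prodMk h.smooth_inv) fun z hz => ⟨hz.1, h.inv_ne_zero hz.1 hz.2⟩
  homogeneous t ht c hc x := by rw [h'.homogeneous t ht c hc, h.homogeneous t ht c hc]
  left_inv t ht x := by rw [h.left_inv t ht, h'.left_inv t ht]
  right_inv t ht x := by rw [h'.right_inv t ht, h.right_inv t ht]
  zero_apply x := by rw [h'.zero_apply, h.zero_apply]
  symplectic t ht x hx u v := by
    have hd : fderiv ℝ (fun x => Ψ t (Θ t x)) x =
        (fderiv ℝ (Ψ t) (Θ t x)).comp (fderiv ℝ (Θ t) x) :=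
      ((h.hasFDerivAt ht (h'.ne_zero ht hx)).comp x (h'.hasFDerivAt ht hx)).fderiv
    rw [hd, ContinuousLinearMap.comp_apply, ContinuousLinearMap.comp_apply,
      h.symplectic t ht _ (h'.ne_zero ht hx), h'.symplectic t ht x hx]

end IsSymplecticFamily

section Cayley

/-- The derivative of a Hamiltonian vector field is an infinitesimally symplectic map, because
second derivatives are symmetric. -/
theorem inner_rotation_fderiv_hamField {S : PhaseSpace n → ℝ} (hS : IsHomogeneousSmooth S)
    {x : PhaseSpace n} (hx : x ≠ 0) (u v : PhaseSpace n) :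
    inner ℝ (rotation (fderiv ℝ (hamField S) x u)) v +
      inner ℝ (rotation u) (fderiv ℝ (hamField S) x v) = 0 := by
  have hd : HasFDerivAt (hamField S) (fderiv ℝ (hamField S) x) x :=
    ((hS.contDiffOn_hamField.contDiffAt (isOpen_compl_zero.mem_nhds hx)).differentiableAt
      (by simp)).hasFDerivAt
  have hd2 : HasFDerivAt (fderiv ℝ S) (fderiv ℝ (fderiv ℝ S) x) x :=
    (((hS.smooth.fderiv_of_isOpen isOpen_compl_zero (m := ∞) (by simp)).contDiffAt
      (isOpen_compl_zero.mem_nhds hx)).differentiableAt (by simp)).hasFDerivAt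
  have key : ∀ u v, inner ℝ (rotation (fderiv ℝ (hamField S) x u)) v =
      -fderiv ℝ (fderiv ℝ S) x u v := by
    intro u v
    have h1 : HasFDerivAt (fun y => inner ℝ (rotation (hamField S y)) v)
        (((innerSL ℝ v).comp rotation).comp (fderiv ℝ (hamField S) x)) x := by
      have := ((innerSL ℝ v).comp (rotation (n := n))).hasFDerivAt.comp x hd
      refine this.congr_of_eventuallyEq (Eventually.of_forall fun y => ?_)
      simp [real_inner_comm]
    have h2 : HasFDerivAt (fun y => -fderiv ℝ S y v)
        (-((ContinuousLinearMap.apply ℝ ℝ v).comp (fderiv ℝ (fderiv ℝ S) x))) x :=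
      ((ContinuousLinearMap.apply ℝ ℝ v).hasFDerivAt.comp x hd2).neg
    simp_rw [inner_rotation_hamField] at h1
    have h3 := congrArg (fun A : PhaseSpace n →L[ℝ] ℝ => A u) (h1.unique h2)
    simpa [real_inner_comm] using h3
  have hsymm := ((hS.contDiffAt hx).isSymmSndFDerivAt
    (by
      simp only [minSmoothness_of_isRCLikeNormedField]
      exact WithTop.coe_le_coe.2 le_top)).eq u v
  rw [inner_rotation_swap u, key, key, hsymm]
  ring

/-- The map `m ↦ m + (s / 2) J ∇S(m)`. The quotient of two of these, with parameters `s` and `-s`,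
is the Cayley transform of `S`. -/
noncomputable def halfStep (S : PhaseSpace n → ℝ) (s : ℝ) (m : PhaseSpace n) : PhaseSpace n :=
  m + (s / 2) • hamField S m

theorem halfStep_smul {S : PhaseSpace n → ℝ} (hS : IsHomogeneousSmooth S) (s : ℝ) {c : ℝ}
    (hc : 0 < c) (m : PhaseSpace n) : halfStep S s (c • m) = c • halfStep S s m := by
  rw [halfStep, halfStep, hS.hamField_smul hc, smul_add, smul_comm]

theorem halfStep_zero_right {S : PhaseSpace n → ℝ} (hS : IsHomogeneousSmooth S) (s : ℝ) :
    halfStep S s 0 = 0 := by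
  have := halfStep_smul hS s two_pos 0
  rw [smul_zero, two_smul] at this
  simpa using this

theorem norm_sub_le_halfStep {S : PhaseSpace n → ℝ} {L s : ℝ}
    (hL : ∀ x y, ‖hamField S x - hamField S y‖ ≤ L * ‖x - y‖) (hs : |s| * L ≤ 1)
    (x y : PhaseSpace n) : ‖x - y‖ ≤ 2 * ‖halfStep S s x - halfStep S s y‖ := by
  have h1 : x - y = (halfStep S s x - halfStep S s y) -
      (s / 2) • (hamField S x - hamField S y) := by
    simp only [halfStep, smul_sub]
    abel
  have h2 : ‖(s / 2) • (hamField S x - hamField S y)‖ ≤ 1 / 2 * ‖x - y‖ := by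
    rw [norm_smul, Real.norm_eq_abs, abs_div, abs_two]
    calc |s| / 2 * ‖hamField S x - hamField S y‖ ≤ |s| / 2 * (L * ‖x - y‖) := by
          gcongr; exact hL x y
      _ = |s| * L / 2 * ‖x - y‖ := by ring
      _ ≤ 1 / 2 * ‖x - y‖ := by gcongr
  have h3 : ‖x - y‖ ≤ ‖halfStep S s x - halfStep S s y‖ +
      ‖(s / 2) • (hamField S x - hamField S y)‖ := by
    conv_lhs => rw [h1]
    exact norm_sub_le _ _
  linarith

theorem halfStep_bijective {S : PhaseSpace n → ℝ} {L s : ℝ}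
    (hL : ∀ x y, ‖hamField S x - hamField S y‖ ≤ L * ‖x - y‖) (hs : |s| * L ≤ 1) :
    Function.Bijective (halfStep S s) := by
  refine ⟨fun x y hxy => ?_, fun x => ?_⟩
  · have := norm_sub_le_halfStep hL hs x y
    rw [hxy, sub_self, norm_zero, mul_zero] at this
    exact sub_eq_zero.1 (norm_le_zero_iff.1 this)
  · have hc : ContractingWith (1 / 2) (fun m => x - (s / 2) • hamField S m) := by
      refine ⟨by norm_num, LipschitzWith.of_dist_le_mul fun a b => ?_⟩
      rw [dist_eq_norm, dist_eq_norm, sub_sub_sub_cancel_left, ← smul_sub, norm_smul,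
        Real.norm_eq_abs, abs_div, abs_two, norm_sub_rev]
      calc |s| / 2 * ‖hamField S a - hamField S b‖ ≤ |s| / 2 * (L * ‖a - b‖) := by
            gcongr; exact hL a b
        _ = |s| * L / 2 * ‖a - b‖ := by ring
        _ ≤ _ := by push_cast; gcongr
    refine ⟨hc.fixedPoint, ?_⟩
    have := hc.fixedPoint_isFixedPt
    rw [Function.IsFixedPt] at this
    nth_rewrite 1 [halfStep]
    nth_rewrite 1 [← this]
    simp

theorem contDiffOn_halfStep {S : PhaseSpace n → ℝ} (hS : IsHomogeneousSmooth S) :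
    ContDiffOn ℝ ∞ (fun z : ℝ × PhaseSpace n => halfStep S z.1 z.2) (univ ×ˢ {0}ᶜ) :=
  contDiffOn_snd.add ((contDiffOn_fst.div_const 2).smul
    (hS.contDiffOn_hamField.comp contDiffOn_snd fun _ hz => hz.2))

theorem hasFDerivAt_halfStep {S : PhaseSpace n → ℝ} (hS : IsHomogeneousSmooth S) (s : ℝ)
    {x : PhaseSpace n} (hx : x ≠ 0) :
    HasFDerivAt (halfStep S s)
      (ContinuousLinearMap.id ℝ _ + (s / 2) • fderiv ℝ (hamField S) x) x :=
  (hasFDerivAt_id x).add (((hS.contDiffOn_hamField.contDiffAt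
    (isOpen_compl_zero.mem_nhds hx)).differentiableAt (by simp)).hasFDerivAt.const_smul (s / 2))

/-- The inverse of `halfStep S s`, for small `s`. -/
noncomputable def halfStepInv (S : PhaseSpace n → ℝ) (s : ℝ) : PhaseSpace n → PhaseSpace n :=
  Function.invFun (halfStep S s)

/-- The Cayley transform of `S` with parameter `s`, that is, the map `x ↦ y` given implicitly by
`y - x = s J ∇S((x + y) / 2)`. -/
noncomputable def cayley (S : PhaseSpace n → ℝ) (s : ℝ) (x : PhaseSpace n) : PhaseSpace n :=
  halfStep S s (halfStepInv S (-s) x)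

/-- The parameter interval `(-σ, σ)` is so small, with respect to a Lipschitz constant of the
Hamiltonian field of `S`, that `halfStep S s` is invertible for `|s| < σ`. -/
structure IsCayleyRadius (S : PhaseSpace n → ℝ) (σ : ℝ) : Prop where
  homogeneousSmooth : IsHomogeneousSmooth S
  lipschitz : ∀ s ∈ Ioo (-σ) σ, ∃ L, 0 ≤ L ∧ |s| * L ≤ 1 ∧
    (∀ x y, ‖hamField S x - hamField S y‖ ≤ L * ‖x - y‖) ∧ ∀ x ≠ 0, ‖fderiv ℝ (hamField S) x‖ ≤ L

theorem exists_isCayleyRadius {S : PhaseSpace n → ℝ} (hS : IsHomogeneousSmooth S) :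
    ∃ σ > 0, IsCayleyRadius S σ := by
  obtain ⟨L, hL0, hL, hdL⟩ := exists_lipschitz_of_homogeneous hS.contDiffOn_hamField
    fun c hc x => hS.hamField_smul hc x
  refine ⟨1 / (L + 1), by positivity, hS, fun s hs => ⟨L, hL0, ?_, hL, hdL⟩⟩
  calc |s| * L ≤ 1 / (L + 1) * (L + 1) := by
        gcongr
        · exact (abs_lt.2 hs).le
        · linarith
    _ = 1 := by field_simp

namespace IsCayleyRadius

variable {S : PhaseSpace n → ℝ} {σ s : ℝ}

theorem neg_mem (hs : s ∈ Ioo (-σ) σ) : -s ∈ Ioo (-σ) σ := ⟨by linarith [hs.2], by linarith [hs.1]⟩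

theorem inv_halfStep (h : IsCayleyRadius S σ) (hs : s ∈ Ioo (-σ) σ) (m : PhaseSpace n) :
    halfStepInv S s (halfStep S s m) = m := by
  obtain ⟨L, -, hsL, hL, -⟩ := h.lipschitz s hs
  exact Function.leftInverse_invFun (halfStep_bijective hL hsL).1 m

theorem halfStep_inv (h : IsCayleyRadius S σ) (hs : s ∈ Ioo (-σ) σ) (x : PhaseSpace n) :
    halfStep S s (halfStepInv S s x) = x := by
  obtain ⟨L, -, hsL, hL, -⟩ := h.lipschitz s hs
  exact Function.rightInverse_invFun (halfStep_bijective hL hsL).2 x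

theorem inv_ne_zero (h : IsCayleyRadius S σ) (hs : s ∈ Ioo (-σ) σ) {x : PhaseSpace n}
    (hx : x ≠ 0) : halfStepInv S s x ≠ 0 := fun h0 => hx <| by
  rw [← h.halfStep_inv hs x, h0, halfStep_zero_right h.homogeneousSmooth]

theorem inv_smul (h : IsCayleyRadius S σ) (hs : s ∈ Ioo (-σ) σ) {c : ℝ} (hc : 0 < c)
    (x : PhaseSpace n) : halfStepInv S s (c • x) = c • halfStepInv S s x := by
  rw [← h.inv_halfStep hs (c • halfStepInv S s x), halfStep_smul h.homogeneousSmooth s hc,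
    h.halfStep_inv hs]

/-- The derivative of `halfStep S s` is injective. -/
theorem injective_fderiv (h : IsCayleyRadius S σ) (hs : s ∈ Ioo (-σ) σ) {x : PhaseSpace n}
    (hx : x ≠ 0) {v : PhaseSpace n} (hv : v + (s / 2) • fderiv ℝ (hamField S) x v = 0) :
    v = 0 := by
  obtain ⟨L, hL0, hsL, -, hdL⟩ := h.lipschitz s hs
  have h1 : ‖v‖ ≤ 1 / 2 * ‖v‖ := by
    calc ‖v‖ = ‖(s / 2) • fderiv ℝ (hamField S) x v‖ := by
          rw [← norm_neg v, ← eq_neg_of_add_eq_zero_right hv]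
      _ = |s| / 2 * ‖fderiv ℝ (hamField S) x v‖ := by
          rw [norm_smul, Real.norm_eq_abs, abs_div, abs_two]
      _ ≤ |s| / 2 * (L * ‖v‖) := by
          gcongr; exact (fderiv ℝ (hamField S) x).le_of_opNorm_le (hdL x hx) v
      _ = |s| * L / 2 * ‖v‖ := by ring
      _ ≤ 1 / 2 * ‖v‖ := by gcongr
  exact norm_le_zero_iff.1 (by linarith)

theorem contDiffOn_inv (h : IsCayleyRadius S σ) :
    ContDiffOn ℝ ∞ (fun z : ℝ × PhaseSpace n => halfStepInv S z.1 z.2)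
      (Ioo (-σ) σ ×ˢ {0}ᶜ) := by
  rintro ⟨s, x⟩ ⟨hs, hx⟩
  apply ContDiffAt.contDiffWithinAt
  have hm : halfStepInv S s x ≠ 0 := h.inv_ne_zero hs hx
  obtain ⟨m, hmdef⟩ : ∃ m, halfStepInv S s x = m := ⟨_, rfl⟩
  rw [hmdef] at hm
  have hmx : halfStep S s m = x := by rw [← hmdef, h.halfStep_inv hs]
  have hAs : ContDiffAt ℝ ∞ (fun z : ℝ × PhaseSpace n => halfStep S z.1 z.2) (s, m) :=
    (contDiffOn_halfStep h.homogeneousSmooth).contDiffAt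
      ((isOpen_univ.prod isOpen_compl_zero).mem_nhds ⟨trivial, hm⟩)
  have hQ : ContDiffAt ℝ ∞ (fun z : ℝ × PhaseSpace n => (z.1, halfStep S z.1 z.2)) (s, m) :=
    contDiffAt_fst.prodMk hAs
  have key := contDiffAt_of_eventually_leftInverse
    (g := fun z : ℝ × PhaseSpace n => (z.1, halfStepInv S z.1 z.2)) hQ ?_ ?_
  · have h1 := contDiffAt_snd.comp _ key
    simpa [Function.comp_def, hmx] using h1
  · rintro ⟨τ, w⟩ hv
    have hd := hAs.differentiableAt (by simp)
    rw [((hasFDerivAt_fst (𝕜 := ℝ) (p := (s, m))).prodMk hd.hasFDerivAt).fderiv] at hv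
    simp only [ContinuousLinearMap.prod_apply, ContinuousLinearMap.coe_fst',
      Prod.mk_eq_zero] at hv
    obtain ⟨rfl, hv⟩ := hv
    have h2 := (hasFDerivAt_halfStep h.homogeneousSmooth s hm).unique
      (hd.hasFDerivAt.comp m (hasFDerivAt_prodMk_right s m))
    have h3 := congrArg (fun A : PhaseSpace n →L[ℝ] PhaseSpace n => A w) h2
    simp only [ContinuousLinearMap.comp_apply, ContinuousLinearMap.inr_apply, hv, add_apply,
      smul_apply, ContinuousLinearMap.id_apply] at h3
    rw [h.injective_fderiv hs hm h3]
    rfl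
  · have : ∀ᶠ z : ℝ × PhaseSpace n in 𝓝 (s, m), z.1 ∈ Ioo (-σ) σ :=
      continuousAt_fst.eventually_mem (isOpen_Ioo.mem_nhds hs)
    filter_upwards [this] with z hz
    rw [h.inv_halfStep hz]

theorem contDiffOn_cayley (h : IsCayleyRadius S σ) :
    ContDiffOn ℝ ∞ (fun z : ℝ × PhaseSpace n => cayley S z.1 z.2) (Ioo (-σ) σ ×ˢ {0}ᶜ) :=
  (contDiffOn_halfStep h.homogeneousSmooth).comp
    (f := fun z : ℝ × PhaseSpace n => (z.1, halfStepInv S (-z.1) z.2))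
    (contDiffOn_fst.prodMk (h.contDiffOn_inv.comp
      (f := fun z : ℝ × PhaseSpace n => (-z.1, z.2)) (ContDiff.contDiffOn (by fun_prop))
      fun _ hz => ⟨neg_mem hz.1, hz.2⟩))
    fun _ hz => ⟨trivial, h.inv_ne_zero (neg_mem hz.1) hz.2⟩

theorem cayley_neg_cayley (h : IsCayleyRadius S σ) (hs : s ∈ Ioo (-σ) σ) (x : PhaseSpace n) :
    cayley S (-s) (cayley S s x) = x := by
  rw [cayley, cayley, neg_neg, h.inv_halfStep hs, h.halfStep_inv (neg_mem hs)]

/-- If `A = Dhalf(-s)` and `B = Dhalf(s)` at the midpoint, the derivative of the Cayley transform is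
`B A⁻¹`, which is symplectic because `D(J ∇S)` is infinitesimally symplectic. -/
theorem cayley_symplectic (h : IsCayleyRadius S σ) (hs : s ∈ Ioo (-σ) σ) {x : PhaseSpace n}
    (hx : x ≠ 0) (u v : PhaseSpace n) :
    inner ℝ (rotation (fderiv ℝ (cayley S s) x u)) (fderiv ℝ (cayley S s) x v) =
      inner ℝ (rotation u) v := by
  have hs' := neg_mem hs
  have hm : halfStepInv S (-s) x ≠ 0 := h.inv_ne_zero hs' hx
  have hxm := h.halfStep_inv hs' x
  generalize halfStepInv S (-s) x = m at hm hxm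
  have hΘ : HasFDerivAt (cayley S s) (fderiv ℝ (cayley S s) x) x :=
    (((contDiffOn_slice h.contDiffOn_cayley hs).contDiffAt
      (isOpen_compl_zero.mem_nhds hx)).differentiableAt (by simp)).hasFDerivAt
  generalize fderiv ℝ (cayley S s) x = D at hΘ
  have h5 := inner_rotation_fderiv_hamField h.homogeneousSmooth hm
  have hplus := hasFDerivAt_halfStep h.homogeneousSmooth s hm
  have hminus := hasFDerivAt_halfStep h.homogeneousSmooth (-s) hm
  have hinj : ∀ w, w + (-s / 2) • fderiv ℝ (hamField S) m w = 0 → w = 0 :=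
    fun w hw => h.injective_fderiv hs' hm hw
  generalize fderiv ℝ (hamField S) m = P at h5 hplus hminus hinj
  have hcomp : ∀ w, D (w + (-s / 2) • P w) = w + (s / 2) • P w := by
    intro w
    rw [← hxm] at hΘ
    have h3 := (hΘ.comp m hminus).congr_of_eventuallyEq (f₁ := halfStep S s)
      (Eventually.of_forall fun y => by
        rw [Function.comp_apply, cayley, h.inv_halfStep hs'])
    have h4 := congrArg (fun A : PhaseSpace n →L[ℝ] PhaseSpace n => A w) (h3.unique hplus)
    simpa using h4
  have hsurj : ∀ u, ∃ w, w + (-s / 2) • P w = u := by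
    have h1 : Function.Injective ((ContinuousLinearMap.id ℝ (PhaseSpace n) +
        (-s / 2) • P : PhaseSpace n →L[ℝ] PhaseSpace n) : PhaseSpace n →ₗ[ℝ] PhaseSpace n) := by
      rw [injective_iff_map_eq_zero]
      exact fun w hw => hinj w (by simpa using hw)
    intro u
    obtain ⟨w, hw⟩ := LinearMap.injective_iff_surjective.1 h1 u
    exact ⟨w, by simpa using hw⟩
  obtain ⟨w, rfl⟩ := hsurj u
  obtain ⟨w', rfl⟩ := hsurj v
  rw [hcomp, hcomp]
  have h6 := h5 w w'
  simp only [map_add, map_smul, inner_add_left, inner_add_right, inner_smul_left,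
    inner_smul_right, RCLike.conj_to_real]
  linear_combination s * h6

theorem isSymplecticFamily (h : IsCayleyRadius S σ) (hσ : 0 < σ) :
    IsSymplecticFamily σ (cayley S) (fun s => cayley S (-s)) where
  smooth := h.contDiffOn_cayley
  smooth_inv := h.contDiffOn_cayley.comp (f := fun z : ℝ × PhaseSpace n => (-z.1, z.2))
    (ContDiff.contDiffOn (by fun_prop)) fun _ hz => ⟨neg_mem hz.1, hz.2⟩
  homogeneous s hs c hc x := by
    rw [cayley, h.inv_smul (neg_mem hs) hc, halfStep_smul h.homogeneousSmooth s hc, ← cayley]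
  left_inv s hs x := h.cayley_neg_cayley hs x
  right_inv s hs x := by
    simpa only [neg_neg] using h.cayley_neg_cayley (neg_mem hs) x
  zero_apply x := by
    have h2 := h.halfStep_inv (s := 0) ⟨by linarith, hσ⟩ x
    rw [cayley, neg_zero, h2]
  symplectic s hs x hx u v := h.cayley_symplectic hs hx u v

/-- The velocity of the Cayley transforms at the identity is the Hamiltonian field of `S`, since
`cayley S s x = x + s J ∇S(m)` for the midpoint `m`. -/
theorem hasDerivAt_cayley (h : IsCayleyRadius S σ) (hσ : 0 < σ) {x : PhaseSpace n} (hx : x ≠ 0) :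
    HasDerivAt (fun s => cayley S s x) (hamField S x) 0 := by
  have h0 : (0 : ℝ) ∈ Ioo (-σ) σ := ⟨by linarith, hσ⟩
  have hform : ∀ᶠ s in 𝓝 (0 : ℝ),
      cayley S s x = x + s • hamField S (halfStepInv S (-s) x) := by
    filter_upwards [isOpen_Ioo.mem_nhds h0] with s hs
    have h1 := h.halfStep_inv (neg_mem hs) x
    have h2 : ∀ m, halfStep S s m = halfStep S (-s) m + s • hamField S m := by
      intro m
      rw [halfStep, halfStep, add_assoc, ← add_smul]
      congr 2
      ring
    rw [cayley, h2, h1]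
  have hBx : DifferentiableAt ℝ (fun s => hamField S (halfStepInv S (-s) x)) 0 := by
    have h1 : ContDiffOn ℝ ∞ (fun s => hamField S (halfStepInv S (-s) x)) (Ioo (-σ) σ) :=
      h.homogeneousSmooth.contDiffOn_hamField.comp
        (h.contDiffOn_inv.comp (f := fun s : ℝ => (-s, x))
          (ContDiff.contDiffOn (by fun_prop)) fun s hs => ⟨neg_mem hs, hx⟩)
        fun s hs => h.inv_ne_zero (neg_mem hs) hx
    exact (h1.contDiffAt (isOpen_Ioo.mem_nhds h0)).differentiableAt (by simp)
  have hB00 : halfStepInv S 0 x = x := by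
    have := h.halfStep_inv h0 x
    simpa [halfStep] using this
  have h1 := ((hasDerivAt_id (0 : ℝ)).smul hBx.hasDerivAt).const_add x
  refine (h1.congr_deriv ?_).congr_of_eventuallyEq hform
  simp [hB00]

end IsCayleyRadius

/-- Every homogeneous function `S` of degree `2` generates a smooth family of symplectic
diffeomorphisms whose velocity at the identity is the Hamiltonian field of `S`. Instead of the
Hamiltonian flow, the family of Cayley transforms is used: its smoothness only needs the inverse
function theorem. -/
theorem exists_isSymplecticFamily {S : PhaseSpace n → ℝ} (hS : IsHomogeneousSmooth S) :
    ∃ σ > 0, ∃ Θ Θi : ℝ → PhaseSpace n → PhaseSpace n, IsSymplecticFamily σ Θ Θi ∧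
      ∀ x ≠ 0, HasDerivAt (fun s => Θ s x) (hamField S x) 0 := by
  obtain ⟨σ, hσ, h⟩ := exists_isCayleyRadius hS
  exact ⟨σ, hσ, _, _, h.isSymplecticFamily hσ, fun x hx => h.hasDerivAt_cayley hσ hx⟩

end Cayley

/-! ### The periodic flow and the homological equation -/

/-- `γ` is the Hamiltonian flow of `H₀` on the complement of the origin; the flow is
homogeneous of degree `1`, and all its orbits have period `T`. -/
structure IsPeriodicHamiltonianFlow (H₀ : PhaseSpace n → ℝ) (T : ℝ)
    (γ : PhaseSpace n → ℝ → PhaseSpace n) : Prop where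
  flow : IsCompleteFlow (hamField H₀) {0}ᶜ γ
  periodic : ∀ x ≠ 0, Function.Periodic (γ x) T
  smul : ∀ c : ℝ, 0 < c → ∀ x s, γ (c • x) s = c • γ x s
  energy : ∀ x ≠ 0, ∀ s, H₀ (γ x s) = H₀ x

/-- The periodic Reeb flow on `{H₀ = 1}` extends, by homogeneity, to the Hamiltonian flow of `H₀`
on the complement of the origin. -/
theorem HasPeriodicReebFlow.exists_flow {H₀ : PhaseSpace n → ℝ} (hH₀ : IsStarHamiltonian H₀)
    {T : ℝ} (hper : HasPeriodicReebFlow H₀ T) :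
    ∃ γ, IsPeriodicHamiltonianFlow H₀ T γ := by
  have hhom : IsHomogeneousSmooth H₀ := hH₀.toIsHomogeneousSmooth
  have hex : ∀ y, ∃ c : ℝ → PhaseSpace n, H₀ y = 1 →
      ((∀ t, H₀ (c t) = 1) ∧ (∀ t, HasDerivAt c (hamField H₀ (c t)) t)) ∧ c 0 = y ∧
        Function.Periodic c T := by
    intro y
    by_cases hy : H₀ y = 1
    · obtain ⟨c, h1, h2, h3⟩ := hper.2 y hy
      exact ⟨c, fun _ => ⟨(isCharacteristic_iff hhom).1 h1, h2, h3⟩⟩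
    · exact ⟨0, fun h => absurd h hy⟩
  choose c hc using hex
  have hsq : ∀ x : PhaseSpace n, x ≠ 0 → 0 < Real.sqrt (H₀ x) :=
    fun x hx => Real.sqrt_pos.2 (hH₀.pos hx)
  have hnorm : ∀ x : PhaseSpace n, x ≠ 0 → H₀ ((Real.sqrt (H₀ x))⁻¹ • x) = 1 := by
    intro x hx
    rw [hhom.homogeneous _ (inv_pos.2 (hsq x hx)), inv_pow, Real.sq_sqrt (hH₀.nonneg x),
      inv_mul_cancel₀ (hH₀.pos hx).ne']
  have hc0 : ∀ x : PhaseSpace n, x ≠ 0 → ∀ s, c ((Real.sqrt (H₀ x))⁻¹ • x) s ≠ 0 := by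
    intro x hx s h0
    have := (hc _ (hnorm x hx)).1.1 s
    rw [h0, hhom.map_zero] at this
    exact zero_ne_one this
  refine ⟨fun x s => Real.sqrt (H₀ x) • c ((Real.sqrt (H₀ x))⁻¹ • x) s,
    ⟨fun x hx => ?_, fun x hx t => ?_, fun x hx t => ?_⟩, fun x hx s => ?_,
    fun a ha x s => ?_, fun x hx s => ?_⟩
  · rw [(hc _ (hnorm x hx)).2.1, smul_inv_smul₀ (hsq x hx).ne']
  · exact smul_ne_zero (hsq x hx).ne' (hc0 x hx t)
  · rw [hhom.hamField_smul (hsq x hx)]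
    exact ((hc _ (hnorm x hx)).1.2 t).const_smul (Real.sqrt (H₀ x))
  · rw [(hc _ (hnorm x hx)).2.2 s]
  · have h1 : Real.sqrt (H₀ (a • x)) = a * Real.sqrt (H₀ x) := by
      rw [hhom.homogeneous a ha, Real.sqrt_mul (sq_nonneg a), Real.sqrt_sq ha.le]
    rw [h1, mul_inv_rev, mul_smul _ _ (a • x), inv_smul_smul₀ ha.ne', mul_smul]
  · rw [hhom.homogeneous _ (hsq x hx), (hc _ (hnorm x hx)).1.1 s,
      Real.sq_sqrt (hH₀.nonneg x), mul_one]

namespace IsPeriodicHamiltonianFlow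

variable {H₀ : PhaseSpace n → ℝ} {T : ℝ} {γ : PhaseSpace n → ℝ → PhaseSpace n}

/-- Weighted integrals of a homogeneous function over the orbits of the flow are homogeneous
functions. -/
theorem isHomogeneousSmooth_integral (h : IsPeriodicHamiltonianFlow H₀ T γ)
    (hH₀ : IsHomogeneousSmooth H₀) (hT : 0 < T) {F : PhaseSpace n → ℝ}
    (hF : IsHomogeneousSmooth F) {w : ℝ → ℝ} (hw : ContDiff ℝ ∞ w) :
    IsHomogeneousSmooth fun x => T⁻¹ * ∫ s in (0 : ℝ)..T, w s * F (γ x s) := by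
  refine ⟨contDiffOn_const.mul ?_, fun c hc x => ?_⟩
  · have h1 : ContDiffOn ℝ ∞ (fun z : ℝ × PhaseSpace n => w z.1 * F (γ z.2 z.1))
        (univ ×ˢ {0}ᶜ) :=
      (hw.comp_contDiffOn contDiffOn_fst).mul (hF.smooth.comp
        (h.flow.contDiffOn_uncurry isOpen_compl_zero hH₀.contDiffOn_hamField)
        fun z hz => h.flow.mem _ hz.2 _)
    exact contDiffOn_parametric_intervalIntegral
      (f := fun z : ℝ × PhaseSpace n => w z.1 * F (γ z.2 z.1)) hT.le
      (isOpen_univ.prod isOpen_compl_zero) isOpen_compl_zero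
      (prod_mono (subset_univ _) le_rfl) h1
  · simp_rw [h.smul c hc, hF.homogeneous c hc, mul_left_comm _ (c ^ 2)]
    rw [intervalIntegral.integral_const_mul]
    ring

/-- The homological equation. If `Fb` is the average of `F` over the orbits of the periodic flow of
`H₀`, then `F - Fb` is the derivative along the flow of `S = T⁻¹ ∫₀ᵀ s F(γₛ) ds`. -/
theorem exists_homological_solution (h : IsPeriodicHamiltonianFlow H₀ T γ)
    (hH₀ : IsHomogeneousSmooth H₀) (hT : 0 < T) {F : PhaseSpace n → ℝ}
    (hF : IsHomogeneousSmooth F) :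
    ∃ Fb S : PhaseSpace n → ℝ, IsHomogeneousSmooth Fb ∧ IsHomogeneousSmooth S ∧
      (∀ x ≠ 0, ∀ s, Fb (γ x s) = Fb x) ∧
      ∀ x ≠ 0, fderiv ℝ S x (hamField H₀ x) = F x - Fb x := by
  have hFb := h.isHomogeneousSmooth_integral hH₀ hT hF (w := fun _ => 1) contDiff_const
  have hS := h.isHomogeneousSmooth_integral hH₀ hT hF (w := fun s => s) contDiff_id
  have hgroup : ∀ x ≠ 0, ∀ τ, ∀ s ∈ Icc 0 T, γ (γ x τ) s = γ x (s + τ) := fun x hx τ s hs => by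
    rw [add_comm]
    exact (h.flow.add_of_nonneg isOpen_compl_zero hH₀.contDiffOn_hamField hx τ hs.1).symm
  have hcont : ∀ x ≠ 0, Continuous fun s => F (γ x s) := fun x hx =>
    continuous_iff_continuousAt.2 fun s =>
      ((hF.contDiffAt (h.flow.mem x hx s)).continuousAt).comp (h.flow.deriv x hx s).continuousAt
  have hperF : ∀ x ≠ 0, Function.Periodic (fun s => F (γ x s)) T := fun x hx =>
    (h.periodic x hx).comp F
  refine ⟨_, _, hFb, hS, fun x hx τ => ?_, fun x hx => ?_⟩
  · congr 1
    simp only [one_mul]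
    have h1 : ∫ s in (0 : ℝ)..T, F (γ (γ x τ) s) = ∫ s in (0 : ℝ)..T, F (γ x (s + τ)) := by
      refine intervalIntegral.integral_congr fun s hs => ?_
      rw [uIcc_of_le hT.le] at hs
      simp only [hgroup x hx τ s hs]
    rw [h1, intervalIntegral.integral_comp_add_right (fun s => F (γ x s)), zero_add, add_comm T]
    have := (hperF x hx).intervalIntegral_add_eq τ 0
    rwa [zero_add] at this
  · set u : ℝ → ℝ := fun s => F (γ x s) with hu
    have huc := hcont x hx
    have hup := hperF x hx
    set S : PhaseSpace n → ℝ := fun x => T⁻¹ * ∫ s in (0 : ℝ)..T, s * F (γ x s) with hSdef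
    have h0 : HasDerivAt (fun τ => S (γ x τ)) (fderiv ℝ S x (hamField H₀ x)) 0 := by
      have h1 := h.flow.deriv x hx 0
      rw [h.flow.zero x hx] at h1
      have h2 := hS.hasFDerivAt hx
      rw [← h.flow.zero x hx] at h2
      have h3 := h2.comp_hasDerivAt 0 h1
      rwa [h.flow.zero x hx] at h3
    -- Along the orbit, `T S(γ τ) = ∫_τ^{τ+T} (r - τ) u(r) dr`.
    have hform : ∀ τ, S (γ x τ) = T⁻¹ * ((∫ r in (0 : ℝ)..(τ + T), r * u r) -
        (∫ r in (0 : ℝ)..τ, r * u r) - τ * ∫ r in (0 : ℝ)..T, u r) := by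
      intro τ
      have hi : Continuous fun r => r * u r := continuous_id.mul huc
      have h1 : ∫ s in (0 : ℝ)..T, s * F (γ (γ x τ) s) =
          ∫ s in (0 : ℝ)..T, (fun r => (r - τ) * u r) (s + τ) := by
        refine intervalIntegral.integral_congr fun s hs => ?_
        rw [uIcc_of_le hT.le] at hs
        simp only [hgroup x hx τ s hs, add_sub_cancel_right, hu]
      rw [hSdef]
      simp only
      rw [h1, intervalIntegral.integral_comp_add_right (fun r => (r - τ) * u r), zero_add,
        add_comm T]
      congr 1
      simp_rw [sub_mul]
      rw [intervalIntegral.integral_sub (hi.intervalIntegrable _ _)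
        ((huc.const_mul τ).intervalIntegrable _ _), intervalIntegral.integral_const_mul,
        hup.intervalIntegral_add_eq τ 0, zero_add,
        intervalIntegral.integral_interval_sub_left (hi.intervalIntegrable _ _)
        (hi.intervalIntegrable _ _)]
    have hd : ∀ y, HasDerivAt (fun τ => ∫ r in (0 : ℝ)..τ, r * u r) (y * u y) y := fun y =>
      ((continuous_id.mul huc).integral_hasStrictDerivAt 0 y).hasDerivAt
    have h1 : HasDerivAt (fun τ => S (γ x τ))
        (T⁻¹ * ((0 + T) * u (0 + T) - 0 * u 0 - 1 * ∫ r in (0 : ℝ)..T, u r)) 0 := by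
      simp_rw [hform]
      exact ((((hd (0 + T)).comp_add_const 0 T).sub (hd 0)).sub
        ((hasDerivAt_id (0 : ℝ)).mul_const _)).const_mul _
    rw [h0.unique h1]
    have h2 : u (0 + T) = F x := by
      refine (hup 0).trans ?_
      simp only [h.flow.zero x hx]
    rw [h2]
    simp only [one_mul, hu]
    field_simp
    ring

end IsPeriodicHamiltonianFlow

/-! ### Normal forms of deformations -/

/-- A smooth family of functions on phase space that are homogeneous of degree `2`. -/
structure IsHomogeneousFamily (ε : ℝ) (K : ℝ → PhaseSpace n → ℝ) : Prop where
  smooth : ContDiffOn ℝ ∞ (fun z : ℝ × PhaseSpace n => K z.1 z.2) (Ioo (-ε) ε ×ˢ {0}ᶜ)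
  homogeneous : ∀ t ∈ Ioo (-ε) ε, ∀ c : ℝ, 0 < c → ∀ x, K t (c • x) = c ^ 2 * K t x

namespace IsHomogeneousFamily

variable {ε t : ℝ} {K R : ℝ → PhaseSpace n → ℝ}

theorem isHomogeneousSmooth (h : IsHomogeneousFamily ε K) (ht : t ∈ Ioo (-ε) ε) :
    IsHomogeneousSmooth (K t) := ⟨contDiffOn_slice h.smooth ht, h.homogeneous t ht⟩

theorem mono (h : IsHomogeneousFamily ε K) {ε' : ℝ} (hε : ε' ≤ ε) : IsHomogeneousFamily ε' K :=
  have hsub : Ioo (-ε') ε' ⊆ Ioo (-ε) ε := Ioo_subset_Ioo (neg_le_neg hε) hε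
  ⟨h.smooth.mono (prod_mono hsub le_rfl), fun t ht => h.homogeneous t (hsub ht)⟩

theorem const {F : PhaseSpace n → ℝ} (hF : IsHomogeneousSmooth F) :
    IsHomogeneousFamily ε fun _ => F :=
  ⟨hF.smooth.comp contDiffOn_snd fun _ hz => hz.2, fun _ _ => hF.homogeneous⟩

theorem add (hK : IsHomogeneousFamily ε K) (hR : IsHomogeneousFamily ε R) :
    IsHomogeneousFamily ε fun t x => K t x + R t x :=
  ⟨hK.smooth.add hR.smooth, fun t ht c hc x => by
    rw [hK.homogeneous t ht c hc, hR.homogeneous t ht c hc]; ring⟩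

theorem pow_mul (hK : IsHomogeneousFamily ε K) (k : ℕ) :
    IsHomogeneousFamily ε fun t x => t ^ k * K t x :=
  ⟨(contDiffOn_fst.pow k).mul hK.smooth, fun t ht c hc x => by
    rw [hK.homogeneous t ht c hc]; ring⟩

theorem sum {m : ℕ} {K : Fin m → ℝ → PhaseSpace n → ℝ}
    (hK : ∀ i, IsHomogeneousFamily ε (K i)) :
    IsHomogeneousFamily ε fun t x => ∑ i, K i t x :=
  ⟨ContDiffOn.sum fun i _ => (hK i).smooth, fun t ht c hc x => by
    rw [Finset.mul_sum]
    exact Finset.sum_congr rfl fun i _ => (hK i).homogeneous t ht c hc x⟩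

theorem comp (hK : IsHomogeneousFamily ε K) {Θ Θi : ℝ → PhaseSpace n → PhaseSpace n}
    (hΘ : IsSymplecticFamily ε Θ Θi) : IsHomogeneousFamily ε fun t x => K t (Θ t x) :=
  ⟨hK.smooth.comp (f := fun z : ℝ × PhaseSpace n => (z.1, Θ z.1 z.2))
    (contDiffOn_fst.prodMk hΘ.smooth) fun _ hz => ⟨hz.1, hΘ.ne_zero hz.1 hz.2⟩,
    fun t ht c hc x => by rw [hΘ.homogeneous t ht c hc, hK.homogeneous t ht c hc]⟩

theorem comp_inv (hK : IsHomogeneousFamily ε K) {Θ Θi : ℝ → PhaseSpace n → PhaseSpace n}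
    (hΘ : IsSymplecticFamily ε Θ Θi) : IsHomogeneousFamily ε fun t x => K t (Θi t x) :=
  ⟨hK.smooth.comp (f := fun z : ℝ × PhaseSpace n => (z.1, Θi z.1 z.2))
    (contDiffOn_fst.prodMk hΘ.smooth_inv) fun _ hz => ⟨hz.1, hΘ.inv_ne_zero hz.1 hz.2⟩,
    fun t ht c hc x => by rw [hΘ.inv_homogeneous ht hc, hK.homogeneous t ht c hc]⟩

/-- If `t ^ k R t` is homogeneous for each `t`, then so is `R t`; for `t = 0` by continuity. -/
theorem of_pow_mul {k : ℕ}
    (hs : ContDiffOn ℝ ∞ (fun z : ℝ × PhaseSpace n => R z.1 z.2) (Ioo (-ε) ε ×ˢ {0}ᶜ))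
    (h0 : ∀ t, R t 0 = 0)
    (h : ∀ t ∈ Ioo (-ε) ε, ∀ c : ℝ, 0 < c → ∀ x, t ^ k * R t (c • x) = c ^ 2 * (t ^ k * R t x)) :
    IsHomogeneousFamily ε R := by
  have hne : ∀ t ∈ Ioo (-ε) ε, t ≠ 0 → ∀ c : ℝ, 0 < c → ∀ x, R t (c • x) = c ^ 2 * R t x := by
    intro t ht ht0 c hc x
    refine mul_left_cancel₀ (pow_ne_zero k ht0) ?_
    rw [h t ht c hc x]
    ring
  refine ⟨hs, fun t ht c hc x => ?_⟩
  rcases eq_or_ne t 0 with rfl | ht0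
  · rcases eq_or_ne x 0 with rfl | hx
    · simp [h0]
    · have hcont : ∀ y : PhaseSpace n, y ≠ 0 → Tendsto (fun t => R t y) (𝓝[≠] 0) (𝓝 (R 0 y)) := by
        intro y hy
        have h1 : ContinuousAt (fun z : ℝ × PhaseSpace n => R z.1 z.2) (0, y) :=
          (hs.contDiffAt ((isOpen_Ioo_prod_compl_zero ε).mem_nhds
            (show ((0 : ℝ), y) ∈ _ from ⟨ht, hy⟩))).continuousAt
        have h2 : ContinuousAt (fun t => R t y) 0 :=
          h1.comp (f := fun t : ℝ => (t, y)) (by fun_prop)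
        exact h2.tendsto.mono_left nhdsWithin_le_nhds
      refine tendsto_nhds_unique_of_eventuallyEq (hcont _ (smul_ne_zero hc.ne' hx))
        ((hcont x hx).const_mul (c ^ 2)) ?_
      filter_upwards [self_mem_nhdsWithin, nhdsWithin_le_nhds (isOpen_Ioo.mem_nhds ht)]
        with s hs0 hs
      exact hne s hs hs0 c hc x
  · exact hne t ht ht0 c hc x

end IsHomogeneousFamily

/-- The deformation `G` of `H₀` is in normal form to order `k`: up to the symplectic family `Ψ` and
a remainder of order `t ^ (k + 1)`, it is a family `K` of integrals of motion of the flow `γ`. -/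
structure IsNormalForm (H₀ : PhaseSpace n → ℝ) (γ : PhaseSpace n → ℝ → PhaseSpace n)
    (G : ℝ → PhaseSpace n → ℝ) (k : ℕ) (ε : ℝ) (Ψ Ψi : ℝ → PhaseSpace n → PhaseSpace n)
    (K R : ℝ → PhaseSpace n → ℝ) : Prop where
  pos : 0 < ε
  family : IsSymplecticFamily ε Ψ Ψi
  main : IsHomogeneousFamily ε K
  remainder : IsHomogeneousFamily ε R
  main_zero : ∀ x, K 0 x = H₀ x
  invariant : ∀ t ∈ Ioo (-ε) ε, ∀ x ≠ 0, ∀ s, K t (γ x s) = K t x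
  eq : ∀ t ∈ Ioo (-ε) ε, ∀ x, G t (Ψ t x) = K t x + t ^ (k + 1) * R t x

/-- A normal form to order `k` can be improved to order `k + 1`. The family `Ψ t` is composed with
the symplectic map generated by `t ^ (k + 1) S`, where `S` solves the homological equation for the
leading coefficient `R 0` of the remainder: this replaces `R 0` by its average over the orbits of
the flow, which is an integral of motion. -/
theorem IsNormalForm.exists_succ {H₀ : PhaseSpace n → ℝ} (hH₀ : IsHomogeneousSmooth H₀) {T : ℝ}
    (hT : 0 < T) {γ : PhaseSpace n → ℝ → PhaseSpace n} (hγ : IsPeriodicHamiltonianFlow H₀ T γ)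
    {G : ℝ → PhaseSpace n → ℝ} {k : ℕ} {ε : ℝ} {Ψ Ψi : ℝ → PhaseSpace n → PhaseSpace n}
    {K R : ℝ → PhaseSpace n → ℝ} (h : IsNormalForm H₀ γ G k ε Ψ Ψi K R) :
    ∃ ε' Ψ' Ψi' K' R', IsNormalForm H₀ γ G (k + 1) ε' Ψ' Ψi' K' R' := by
  have hε := h.pos
  have h0 : (0 : ℝ) ∈ Ioo (-ε) ε := ⟨by linarith, hε⟩
  obtain ⟨Fb, S, hFb, hS, hinv, hhomol⟩ := hγ.exists_homological_solution hH₀ hT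
    (h.remainder.isHomogeneousSmooth h0)
  obtain ⟨σ, hσ, Θ, Θi, hΘ, hΘd⟩ := exists_isSymplecticFamily hS
  -- The normal form of order `k`, as a function of `z = (t, x)`.
  set g : ℝ × PhaseSpace n → ℝ := fun z => K z.1 z.2 + z.1 ^ (k + 1) * R z.1 z.2 with hg
  have hgs : ContDiffOn ℝ ∞ g (Ioo (-ε) ε ×ˢ {0}ᶜ) :=
    (h.main.add (h.remainder.pow_mul (k + 1))).smooth
  have hfs : ContDiffOn ℝ ∞
      (fun w : ℝ × (ℝ × PhaseSpace n) => g (w.2.1, Θ w.1 w.2.2))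
      (Ioo (-σ) σ ×ˢ (Ioo (-ε) ε ×ˢ {0}ᶜ)) := by
    refine hgs.comp (f := fun w : ℝ × (ℝ × PhaseSpace n) => (w.2.1, Θ w.1 w.2.2))
      (ContDiffOn.prodMk (ContDiff.contDiffOn (by fun_prop)) ?_)
      fun w hw => ⟨hw.2.1, hΘ.ne_zero hw.1 hw.2.2⟩
    exact hΘ.smooth.comp (f := fun w : ℝ × (ℝ × PhaseSpace n) => (w.1, w.2.2))
      (ContDiff.contDiffOn (by fun_prop)) fun w hw => ⟨hw.1, hw.2.2⟩
  obtain ⟨A, hAs, hA, hA0⟩ := exists_hadamard_quotient hσ (isOpen_Ioo_prod_compl_zero ε) hfs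
  -- Composition with `Θ s` changes `H₀` by `s {H₀, S}` to first order, and `{H₀, S} = Fb - R 0` by
  -- the homological equation.
  have hA00 : ∀ x ≠ 0, A (0, (0, x)) = Fb x - R 0 x := by
    intro x hx
    rw [hA0 (0, x) ⟨h0, hx⟩]
    have h1 : (fun s => g ((0 : ℝ), Θ s x)) = fun s => H₀ (Θ s x) := by
      ext s
      simp [hg, h.main_zero]
    have h2 : HasDerivAt (fun s => H₀ (Θ s x)) (fderiv ℝ H₀ x (hamField S x)) 0 := by
      have h3 : HasFDerivAt H₀ (fderiv ℝ H₀ x) (Θ 0 x) := by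
        rw [hΘ.zero_apply]; exact hH₀.hasFDerivAt hx
      exact h3.comp_hasDerivAt 0 (hΘd x hx)
    simp only
    rw [h1, h2.deriv, fderiv_hamField_swap, hhomol x hx]
    ring
  set ε' : ℝ := min (min ε σ) 1 with hε'
  have hε'0 : 0 < ε' := lt_min (lt_min hε hσ) one_pos
  have hε'ε : ε' ≤ ε := (min_le_left _ _).trans (min_le_left _ _)
  have hsub : Ioo (-ε') ε' ⊆ Ioo (-ε) ε := Ioo_subset_Ioo (neg_le_neg hε'ε) hε'ε
  have hpow : ∀ t ∈ Ioo (-ε') ε', t ^ (k + 1) ∈ Ioo (-σ) σ := by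
    intro t ht
    have h1 : |t| < ε' := abs_lt.2 ht
    rw [mem_Ioo, ← abs_lt, abs_pow, pow_succ]
    have h2 : |t| ^ k ≤ 1 := pow_le_one₀ (abs_nonneg t) (h1.le.trans (min_le_right _ _))
    calc |t| ^ k * |t| ≤ 1 * |t| := by gcongr
      _ < σ := by rw [one_mul]; exact h1.trans_le ((min_le_left _ _).trans (min_le_right _ _))
  have hBs : ContDiffOn ℝ ∞
      (fun z : ℝ × PhaseSpace n => R z.1 z.2 + A (z.1 ^ (k + 1), z)) (Ioo (-ε') ε' ×ˢ {0}ᶜ) :=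
    (h.remainder.mono hε'ε).smooth.add (hAs.comp
      (f := fun z : ℝ × PhaseSpace n => (z.1 ^ (k + 1), z)) (ContDiff.contDiffOn (by fun_prop))
      fun z hz => ⟨hpow _ hz.1, hsub hz.1, hz.2⟩)
  -- With `s = t ^ (k + 1)` the coefficient of `t ^ (k + 1)` is `R t + A`, which is `Fb` at `t = 0`.
  obtain ⟨r, hrs, hr, -⟩ := exists_hadamard_quotient hε'0 isOpen_compl_zero hBs
  have hfam := hΘ.reparam (τ := fun t => t ^ (k + 1)) (by fun_prop) (by simp) hpow
  have hΨ := h.family.reparam (τ := fun t => t) (ε' := ε') contDiff_id rfl fun t ht => hsub ht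
  -- Hadamard's lemma leaves `r` open at the origin, where homogeneity prescribes the value `0`.
  set R' : ℝ → PhaseSpace n → ℝ := fun t x => if x = 0 then 0 else r (t, x) with hR'
  have hmain : IsHomogeneousFamily ε' fun t x => K t x + t ^ (k + 1) * Fb x :=
    (h.main.mono hε'ε).add ((IsHomogeneousFamily.const hFb).pow_mul (k + 1))
  have hkey : ∀ t ∈ Ioo (-ε') ε', ∀ x, g (t, Θ (t ^ (k + 1)) x) =
      K t x + t ^ (k + 1) * Fb x + t ^ (k + 1 + 1) * R' t x := by
    intro t ht x
    rcases eq_or_ne x 0 with rfl | hx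
    · simp only [hg, hR', if_true, hΘ.map_zero (hpow t ht), hFb.map_zero,
        (h.main.isHomogeneousSmooth (hsub ht)).map_zero,
        (h.remainder.isHomogeneousSmooth (hsub ht)).map_zero]
      ring
    · have h1 := hA (t ^ (k + 1)) (hpow t ht) (t, x) ⟨hsub ht, hx⟩
      have h2 := hr t ht x hx
      have h3 := hA00 x hx
      simp only [hΘ.zero_apply, smul_eq_mul, zero_pow (Nat.succ_ne_zero k)] at h1 h2
      rw [h3] at h2
      simp only [hg] at h1 ⊢
      simp only [hR', if_neg hx]
      rw [h1]
      linear_combination t ^ (k + 1) * h2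
  refine ⟨ε', _, _, _, R', hε'0, hΨ.comp hfam, hmain, ?_, fun x => ?_, fun t ht x hx s => ?_,
    fun t ht x => ?_⟩
  · refine IsHomogeneousFamily.of_pow_mul (k := k + 1 + 1)
      (hrs.congr fun z hz => if_neg hz.2) (fun t => if_pos rfl) fun t ht c hc x => ?_
    have h1 := hkey t ht x
    have h2 := hkey t ht (c • x)
    have h3 := ((h.main.add (h.remainder.pow_mul (k + 1))).mono hε'ε).comp hfam
    have h4 := h3.homogeneous t ht c hc x
    have h5 := hmain.homogeneous t ht c hc x
    simp only [hg] at h1 h2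
    linear_combination -h2 + c ^ 2 * h1 + h4 - h5
  · simp [h.main_zero]
  · simp only [h.invariant t (hsub ht) x hx s, hinv x hx s]
  · rw [h.eq t (hsub ht)]
    exact hkey t ht x

/-- Every polynomial deformation of `H₀` has a normal form to each order. -/
theorem exists_isNormalForm {H₀ : PhaseSpace n → ℝ} (hH₀ : IsHomogeneousSmooth H₀) {T : ℝ}
    (hT : 0 < T) {γ : PhaseSpace n → ℝ → PhaseSpace n} (hγ : IsPeriodicHamiltonianFlow H₀ T γ)
    {N : ℕ} {F : Fin N → PhaseSpace n → ℝ} (hF : ∀ i, IsHomogeneousSmooth (F i)) (k : ℕ) :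
    ∃ ε Ψ Ψi K R, IsNormalForm H₀ γ (fun t x => H₀ x + ∑ i : Fin N, t ^ ((i : ℕ) + 1) * F i x)
      k ε Ψ Ψi K R := by
  induction k with
  | zero =>
    refine ⟨1, _, _, fun _ => H₀, fun t x => ∑ i : Fin N, t ^ (i : ℕ) * F i x, one_pos,
      IsSymplecticFamily.refl, IsHomogeneousFamily.const hH₀,
      IsHomogeneousFamily.sum fun i => (IsHomogeneousFamily.const (hF i)).pow_mul i,
      fun x => rfl, fun t ht x hx s => hγ.energy x hx s, fun t ht x => ?_⟩
    rw [Finset.mul_sum]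
    congr 1
    exact Finset.sum_congr rfl fun i _ => by ring
  | succ k ih =>
    obtain ⟨ε, Ψ, Ψi, K, R, h⟩ := ih
    exact h.exists_succ hH₀ hT hγ

/-! ### The contact volume form -/

section ContactForm

/-- The multilinear map `(v₀, …, v₂ₖ) ↦ α(v₀) ∏ⱼ dα(v₂ⱼ₊₁, v₂ⱼ₊₂)`, as a function. -/
noncomputable def contactProduct (k : ℕ) (x : PhaseSpace n) (v : Fin (2 * k + 1) → PhaseSpace n) :
    ℝ :=
  liouville x (v 0) * ∏ j : Fin k, inner ℝ (rotation (v ⟨2 * (j : ℕ) + 1, by omega⟩))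
    (v ⟨2 * (j : ℕ) + 2, by omega⟩)

theorem contactTopForm_eq_sum (k : ℕ) (x : PhaseSpace n) (v : Fin (2 * k + 1) → PhaseSpace n) :
    contactTopForm k x v = (1 / 2 ^ k) * ∑ σ : Equiv.Perm (Fin (2 * k + 1)),
      ((Equiv.Perm.sign σ : ℤ) : ℝ) * contactProduct k x (v ∘ σ) := by
  rw [contactTopForm]
  congr 1
  refine Finset.sum_congr rfl fun σ _ => ?_
  simp only [dLiouville_eq_inner, contactProduct, Function.comp_apply, mul_assoc]

/-- Each argument of `contactProduct` occurs in exactly one factor. -/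
theorem exists_contactProduct_update (k : ℕ) (x : PhaseSpace n) (v : Fin (2 * k + 1) → PhaseSpace n)
    (i : Fin (2 * k + 1)) :
    ∃ φ : PhaseSpace n →L[ℝ] ℝ, ∀ y, contactProduct k x (Function.update v i y) = φ y := by
  have hlt := i.2
  rcases Nat.eq_zero_or_pos (i : ℕ) with hi | hi
  · have hi0 : i = 0 := Fin.ext hi
    subst hi0
    refine ⟨(∏ j : Fin k, inner ℝ (rotation (v ⟨2 * (j : ℕ) + 1, by omega⟩))
      (v ⟨2 * (j : ℕ) + 2, by omega⟩)) • (1 / 2 : ℝ) • innerSL ℝ (rotation x), fun y => ?_⟩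
    have h1 : ∀ (m : ℕ) (hm : m + 1 < 2 * k + 1),
        Function.update v 0 y ⟨m + 1, hm⟩ = v ⟨m + 1, hm⟩ := fun m hm =>
      Function.update_of_ne (Fin.ne_of_val_ne (Nat.succ_ne_zero m)) _ _
    rw [contactProduct, Function.update_self, liouville_eq_inner]
    simp only [h1, smul_apply, innerSL_apply_apply, smul_eq_mul]
    ring
  · obtain ⟨l, hl⟩ : ∃ l : Fin k, (i : ℕ) = 2 * (l : ℕ) + 1 ∨ (i : ℕ) = 2 * (l : ℕ) + 2 :=
      ⟨⟨((i : ℕ) - 1) / 2, by omega⟩, by simp only; omega⟩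
    have h0 : ∀ y, Function.update v i y 0 = v 0 := fun y =>
      Function.update_of_ne (Fin.ne_of_val_ne (by simpa using hi.ne)) _ _
    have hrest : ∀ y, ∏ j ∈ Finset.univ.erase l,
        inner ℝ (rotation (Function.update v i y ⟨2 * (j : ℕ) + 1, by omega⟩))
          (Function.update v i y ⟨2 * (j : ℕ) + 2, by omega⟩) =
        ∏ j ∈ Finset.univ.erase l, inner ℝ (rotation (v ⟨2 * (j : ℕ) + 1, by omega⟩))
          (v ⟨2 * (j : ℕ) + 2, by omega⟩) := by
      intro y
      refine Finset.prod_congr rfl fun j hj => ?_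
      have hjl : (j : ℕ) ≠ l := fun h => (Finset.ne_of_mem_erase hj) (Fin.ext h)
      rw [Function.update_of_ne (Fin.ne_of_val_ne (by simp only; omega)),
        Function.update_of_ne (Fin.ne_of_val_ne (by simp only; omega))]
    have hprod : ∀ y, contactProduct k x (Function.update v i y) = liouville x (v 0) *
        (inner ℝ (rotation (Function.update v i y ⟨2 * (l : ℕ) + 1, by omega⟩))
          (Function.update v i y ⟨2 * (l : ℕ) + 2, by omega⟩) *
        ∏ j ∈ Finset.univ.erase l, inner ℝ (rotation (v ⟨2 * (j : ℕ) + 1, by omega⟩))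
          (v ⟨2 * (j : ℕ) + 2, by omega⟩)) := by
      intro y
      rw [contactProduct, h0, ← Finset.mul_prod_erase _ _ (Finset.mem_univ l), hrest]
    rcases hl with hl | hl
    · refine ⟨(-(liouville x (v 0) * ∏ j ∈ Finset.univ.erase l,
        inner ℝ (rotation (v ⟨2 * (j : ℕ) + 1, by omega⟩)) (v ⟨2 * (j : ℕ) + 2, by omega⟩))) •
        innerSL ℝ (rotation (v ⟨2 * (l : ℕ) + 2, by omega⟩)), fun y => ?_⟩
      have hi' : i = ⟨2 * (l : ℕ) + 1, by omega⟩ := Fin.ext hl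
      rw [hprod, ← hi', Function.update_self,
        Function.update_of_ne (Fin.ne_of_val_ne (by simp only; omega)), inner_rotation_swap]
      simp only [smul_apply, innerSL_apply_apply, smul_eq_mul]
      ring
    · refine ⟨(liouville x (v 0) * ∏ j ∈ Finset.univ.erase l,
        inner ℝ (rotation (v ⟨2 * (j : ℕ) + 1, by omega⟩)) (v ⟨2 * (j : ℕ) + 2, by omega⟩)) •
        innerSL ℝ (rotation (v ⟨2 * (l : ℕ) + 1, by omega⟩)), fun y => ?_⟩
      have hi' : i = ⟨2 * (l : ℕ) + 2, by omega⟩ := Fin.ext hl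
      rw [hprod, ← hi', Function.update_self,
        Function.update_of_ne (Fin.ne_of_val_ne (by simp only; omega))]
      simp only [smul_apply, innerSL_apply_apply, smul_eq_mul]
      ring

/-- `contactProduct` as a multilinear map. -/
noncomputable def contactMultilinear (k : ℕ) (x : PhaseSpace n) :
    MultilinearMap ℝ (fun _ : Fin (2 * k + 1) => PhaseSpace n) ℝ :=
  MultilinearMap.mk' (contactProduct k x)
    (fun v i y z => by
      obtain ⟨φ, hφ⟩ := exists_contactProduct_update k x v i
      rw [hφ, hφ, hφ, map_add])
    (fun v i c y => by
      obtain ⟨φ, hφ⟩ := exists_contactProduct_update k x v i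
      rw [hφ, hφ, map_smul])

theorem contactTopForm_eq_alternatization (k : ℕ) (x : PhaseSpace n)
    (v : Fin (2 * k + 1) → PhaseSpace n) :
    contactTopForm k x v =
      (1 / 2 ^ k) * MultilinearMap.alternatization (contactMultilinear k x) v := by
  rw [contactTopForm_eq_sum, MultilinearMap.alternatization_apply]
  congr 1
  refine Finset.sum_congr rfl fun σ _ => ?_
  rw [Units.smul_def, zsmul_eq_mul]
  rfl

/-- If one of the arguments of `contactProduct` is the base point `x`, then the argument of `α` and
the argument paired with `x` can be exchanged, since `dα(x, ·) = 2 α(·)` at `x`. -/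
theorem exists_contactProduct_swap (k : ℕ) (x : PhaseSpace n) (p : Fin (2 * k + 1)) (hp : p ≠ 0) :
    ∃ q : Fin (2 * k + 1), q ≠ 0 ∧ q ≠ p ∧ ∀ y : Fin (2 * k + 1) → PhaseSpace n, y p = x →
      contactProduct k x (y ∘ Equiv.swap 0 q) = contactProduct k x y := by
  have hlt := p.2
  have hp' : (p : ℕ) ≠ 0 := fun h => hp (Fin.ext h)
  have hfix : ∀ (q : Fin (2 * k + 1)) (m : ℕ) (hm : m < 2 * k + 1), m ≠ 0 → m ≠ q →
      Equiv.swap 0 q ⟨m, hm⟩ = ⟨m, hm⟩ := fun q m hm h1 h2 =>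
    Equiv.swap_apply_of_ne_of_ne (Fin.ne_of_val_ne h1) (Fin.ne_of_val_ne h2)
  obtain ⟨l, hl⟩ : ∃ l : Fin k, (p : ℕ) = 2 * (l : ℕ) + 1 ∨ (p : ℕ) = 2 * (l : ℕ) + 2 :=
    ⟨⟨((p : ℕ) - 1) / 2, by omega⟩, by simp only; omega⟩
  have hrest : ∀ q : Fin (2 * k + 1), (q : ℕ) = 2 * (l : ℕ) + 1 ∨ (q : ℕ) = 2 * (l : ℕ) + 2 →
      ∀ y : Fin (2 * k + 1) → PhaseSpace n, ∏ j ∈ Finset.univ.erase l,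
        inner ℝ (rotation ((y ∘ Equiv.swap 0 q) ⟨2 * (j : ℕ) + 1, by omega⟩))
          ((y ∘ Equiv.swap 0 q) ⟨2 * (j : ℕ) + 2, by omega⟩) =
        ∏ j ∈ Finset.univ.erase l, inner ℝ (rotation (y ⟨2 * (j : ℕ) + 1, by omega⟩))
          (y ⟨2 * (j : ℕ) + 2, by omega⟩) := by
    intro q hq y
    refine Finset.prod_congr rfl fun j hj => ?_
    have hjl : (j : ℕ) ≠ l := fun h => (Finset.ne_of_mem_erase hj) (Fin.ext h)
    rw [Function.comp_apply, Function.comp_apply, hfix q _ _ (by omega) (by omega),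
      hfix q _ _ (by omega) (by omega)]
  rcases hl with hl | hl
  · have hpe : p = ⟨2 * (l : ℕ) + 1, by omega⟩ := Fin.ext hl
    refine ⟨⟨2 * (l : ℕ) + 2, by omega⟩, Fin.ne_of_val_ne (by simp), Fin.ne_of_val_ne (by
      simp only; omega), fun y hy => ?_⟩
    rw [contactProduct, contactProduct, ← Finset.mul_prod_erase _ _ (Finset.mem_univ l),
      ← Finset.mul_prod_erase _ _ (Finset.mem_univ l), hrest _ (Or.inr rfl)]
    simp only [Function.comp_apply, Equiv.swap_apply_left, Equiv.swap_apply_right]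
    rw [hfix _ _ _ (by omega) (by simp only; omega), ← hpe, hy, liouville_eq_inner,
      liouville_eq_inner]
    ring
  · have hpe : p = ⟨2 * (l : ℕ) + 2, by omega⟩ := Fin.ext hl
    refine ⟨⟨2 * (l : ℕ) + 1, by omega⟩, Fin.ne_of_val_ne (by simp), Fin.ne_of_val_ne (by
      simp only; omega), fun y hy => ?_⟩
    rw [contactProduct, contactProduct, ← Finset.mul_prod_erase _ _ (Finset.mem_univ l),
      ← Finset.mul_prod_erase _ _ (Finset.mem_univ l), hrest _ (Or.inl rfl)]
    simp only [Function.comp_apply, Equiv.swap_apply_left, Equiv.swap_apply_right]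
    rw [hfix _ _ _ (by omega) (by simp only; omega), ← hpe, hy, liouville_eq_inner,
      liouville_eq_inner, inner_rotation_swap (y 0) x,
      inner_rotation_swap (y ⟨2 * (l : ℕ) + 1, by omega⟩) x]
    ring

/-- The radial direction is in the kernel of `α ∧ (dα)ᵏ`. -/
theorem contactTopForm_eq_zero_of_mem (k : ℕ) (x : PhaseSpace n)
    (v : Fin (2 * k + 1) → PhaseSpace n) (j : Fin (2 * k + 1)) (hj : v j = x) :
    contactTopForm k x v = 0 := by
  classical
  have hex : ∀ p : Fin (2 * k + 1), ∃ q : Fin (2 * k + 1), (p ≠ 0 → q ≠ 0 ∧ q ≠ p) ∧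
      (p = 0 → q = 0) ∧ ∀ y : Fin (2 * k + 1) → PhaseSpace n, y p = x →
      contactProduct k x (y ∘ Equiv.swap 0 q) = contactProduct k x y := by
    intro p
    by_cases hp : p = 0
    · exact ⟨0, fun h => absurd hp h, fun _ => rfl, fun y _ => by simp⟩
    · obtain ⟨q, h1, h2, h3⟩ := exists_contactProduct_swap k x p hp
      exact ⟨q, fun _ => ⟨h1, h2⟩, fun h => absurd h hp, h3⟩
  choose q hq hq0 hswap using hex
  rw [contactTopForm_eq_sum]
  have hsum : ∑ σ : Equiv.Perm (Fin (2 * k + 1)),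
      ((Equiv.Perm.sign σ : ℤ) : ℝ) * contactProduct k x (v ∘ σ) = 0 := by
    -- The terms cancel in pairs `σ`, `σ ∘ (0 q)`, where `q` is paired with the place of `x`.
    have hzero : ∀ σ : Equiv.Perm (Fin (2 * k + 1)), σ.symm j = 0 →
        contactProduct k x (v ∘ σ) = 0 := by
      intro σ hσ
      have : σ 0 = j := by rw [← hσ, Equiv.apply_symm_apply]
      rw [contactProduct, Function.comp_apply, this, hj, liouville_eq_inner, inner_rotation_self]
      simp
    refine Finset.sum_involution (fun σ _ => σ * Equiv.swap 0 (q (σ.symm j))) ?_ ?_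
      (fun _ _ => Finset.mem_univ _) ?_
    · intro σ _
      by_cases hp : σ.symm j = 0
      · rw [hq0 _ hp, Equiv.swap_self]
        rw [show σ * Equiv.refl _ = σ from rfl, hzero σ hp]
        simp
      · have h1 : contactProduct k x
            (v ∘ (σ * Equiv.swap 0 (q (σ.symm j)) : Equiv.Perm (Fin (2 * k + 1)))) =
            contactProduct k x (v ∘ σ) := by
          rw [Equiv.Perm.coe_mul, ← Function.comp_assoc]
          exact hswap _ _ (by simp [hj])
        rw [h1, Equiv.Perm.sign_mul, Equiv.Perm.sign_swap (hq _ hp).1.symm]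
        push_cast
        ring
    · intro σ _ hne hfix
      have hp : σ.symm j ≠ 0 := fun h => hne (by rw [hzero σ h, mul_zero])
      have h1 := congrArg (fun τ : Equiv.Perm (Fin (2 * k + 1)) => τ 0) hfix
      simp only [Equiv.Perm.mul_apply, Equiv.swap_apply_left] at h1
      exact (hq _ hp).1 (σ.injective h1)
    · intro σ _
      by_cases hp : σ.symm j = 0
      · have h1 : σ * Equiv.swap 0 (q (σ.symm j)) = σ := by
          rw [hq0 _ hp, Equiv.swap_self]; rfl
        simp only [h1]
      · have h1 : (σ * Equiv.swap 0 (q (σ.symm j))).symm j = σ.symm j := by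
          rw [Equiv.symm_apply_eq, Equiv.Perm.mul_apply,
            Equiv.swap_apply_of_ne_of_ne hp (hq _ hp).2.symm, Equiv.apply_symm_apply]
        simp only [h1, mul_assoc, Equiv.swap_mul_self, mul_one]
  rw [hsum, mul_zero]

/-- The form `(x, v₀, …, v₂ₖ) ↦ (α ∧ (dα)ᵏ)ₓ(v₀, …, v₂ₖ)` is alternating in all its arguments: it is
a multiple of `(dα)ᵏ⁺¹`. -/
noncomputable def contactAlternating (n k : ℕ) :
    PhaseSpace n [⋀^Fin (2 * k + 1 + 1)]→ₗ[ℝ] ℝ :=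
  { MultilinearMap.mk' (fun w : Fin (2 * k + 1 + 1) → PhaseSpace n =>
      contactTopForm k (w 0) (Fin.tail w))
      (fun w i y z => by
        refine Fin.cases ?_ (fun i => ?_) i
        · have hadd : ∀ v : PhaseSpace n, liouville (y + z) v = liouville y v + liouville z v := by
            intro v
            simp only [liouville_eq_inner, map_add, inner_add_left, mul_add]
          simp only [Function.update_self, Fin.tail_update_zero, contactTopForm_eq_sum,
            contactProduct, hadd]
          rw [← mul_add, ← Finset.sum_add_distrib]
          congr 1
          exact Finset.sum_congr rfl fun σ _ => by ring
        · simp only [Function.update_of_ne (Fin.succ_ne_zero i).symm, Fin.tail_update_succ,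
            contactTopForm_eq_alternatization]
          rw [AlternatingMap.map_update_add, mul_add])
      (fun w i c y => by
        refine Fin.cases ?_ (fun i => ?_) i
        · have hsmul : ∀ v : PhaseSpace n, liouville (c • y) v = c * liouville y v := by
            intro v
            simp only [liouville_eq_inner, map_smul, inner_smul_left, RCLike.conj_to_real]
            ring
          simp only [Function.update_self, Fin.tail_update_zero, contactTopForm_eq_sum,
            contactProduct, hsmul, smul_eq_mul]
          rw [mul_left_comm]
          congr 1
          rw [Finset.mul_sum]
          exact Finset.sum_congr rfl fun σ _ => by ring
        · simp only [Function.update_of_ne (Fin.succ_ne_zero i).symm, Fin.tail_update_succ,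
            contactTopForm_eq_alternatization]
          rw [AlternatingMap.map_update_smul, smul_eq_mul, smul_eq_mul, mul_left_comm]) with
    map_eq_zero_of_eq' := by
      intro w i j hij hne
      change contactTopForm k (w 0) (Fin.tail w) = 0
      revert hij hne
      refine Fin.cases ?_ (fun i => ?_) i <;> refine Fin.cases ?_ (fun j => ?_) j
      · exact fun _ h => absurd rfl h
      · exact fun h _ => contactTopForm_eq_zero_of_mem k _ _ j h.symm
      · exact fun h _ => contactTopForm_eq_zero_of_mem k _ _ i h
      · intro h hne
        rw [contactTopForm_eq_alternatization,
          AlternatingMap.map_eq_zero_of_eq _ (Fin.tail w) (i := i) (j := j) h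
            fun h => hne (by rw [h]), mul_zero] }

theorem contactAlternating_cons (k : ℕ) (x : PhaseSpace n) (v : Fin (2 * k + 1) → PhaseSpace n) :
    contactAlternating n k (Fin.cons x v) = contactTopForm k x v := rfl

end ContactForm

/-! ### Contact volume and Lebesgue measure -/

section ContactVolume

theorem finrank_phaseSpace (n : ℕ) (hn : 1 ≤ n) :
    Module.finrank ℝ (PhaseSpace n) = 2 * (n - 1) + 1 + 1 := by
  simp
  omega

/-- An orthonormal basis of phase space, indexed as the arguments of `contactAlternating`. -/
noncomputable def frameBasis (n : ℕ) (hn : 1 ≤ n) :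
    OrthonormalBasis (Fin (2 * (n - 1) + 1 + 1)) ℝ (PhaseSpace n) :=
  (stdOrthonormalBasis ℝ (PhaseSpace n)).reindex (finCongr (finrank_phaseSpace n hn))

theorem contactAlternating_eq_det (hn : 1 ≤ n) (w : Fin (2 * (n - 1) + 1 + 1) → PhaseSpace n) :
    contactAlternating n (n - 1) w = contactAlternating n (n - 1) (frameBasis n hn) *
      (frameBasis n hn).toBasis.det w := by
  have h := (contactAlternating n (n - 1)).eq_smul_basis_det (frameBasis n hn).toBasis
  have h2 := congrArg (fun f : PhaseSpace n [⋀^Fin (2 * (n - 1) + 1 + 1)]→ₗ[ℝ] ℝ => f w) h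
  simpa using h2

/-- Adding multiples of the radial vector to the tangent vectors does not change the form. -/
theorem contactAlternating_cons_add (hn : 1 ≤ n) (x : PhaseSpace n)
    (e : Fin (2 * (n - 1) + 1) → PhaseSpace n) (β : Fin (2 * (n - 1) + 1) → ℝ) :
    contactAlternating n (n - 1) (Fin.cons x fun i => e i + β i • x) =
      contactAlternating n (n - 1) (Fin.cons x e) := by
  rw [contactAlternating_eq_det hn (Fin.cons x fun i => e i + β i • x),
    contactAlternating_eq_det hn (Fin.cons x e), Module.Basis.det_apply, Module.Basis.det_apply,
    ← Matrix.det_transpose ((frameBasis n hn).toBasis.toMatrix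
      (Fin.cons x fun i => e i + β i • x)),
    ← Matrix.det_transpose ((frameBasis n hn).toBasis.toMatrix (Fin.cons x e))]
  congr 1
  refine Matrix.det_eq_of_forall_row_eq_smul_add_const (Fin.cons 0 β) 0 rfl fun i j => ?_
  refine Fin.cases ?_ (fun i => ?_) i
  · simp [Module.Basis.toMatrix_apply]
  · simp [Module.Basis.toMatrix_apply]

theorem abs_contactAlternating_of_orthonormal (hn : 1 ≤ n)
    {w : Fin (2 * (n - 1) + 1 + 1) → PhaseSpace n} (hw : Orthonormal ℝ w) :
    |contactAlternating n (n - 1) w| = |contactAlternating n (n - 1) (frameBasis n hn)| := by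
  have hcard : Fintype.card (Fin (2 * (n - 1) + 1 + 1)) = Module.finrank ℝ (PhaseSpace n) := by
    rw [finrank_phaseSpace n hn, Fintype.card_fin]
  have hspan : ⊤ ≤ Submodule.span ℝ (Set.range w) := by
    rw [hw.linearIndependent.span_eq_top_of_card_eq_finrank hcard]
  have h1 := (frameBasis n hn).det_to_matrix_orthonormalBasis (OrthonormalBasis.mk hw hspan)
  rw [OrthonormalBasis.coe_mk, Real.norm_eq_abs] at h1
  rw [contactAlternating_eq_det hn, abs_mul, h1, mul_one]

theorem tangentFrames_nonempty (hn : 1 ≤ n) {x : PhaseSpace n} (hx : ‖x‖ = 1) :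
    (tangentFrames x).Nonempty := by
  have : Fact (Module.finrank ℝ (PhaseSpace n) = 2 * (n - 1) + 1 + 1) :=
    ⟨finrank_phaseSpace n hn⟩
  have hx0 : x ≠ 0 := fun h => by simp [h] at hx
  have hfr : Module.finrank ℝ (ℝ ∙ x)ᗮ = 2 * (n - 1) + 1 :=
    Submodule.finrank_orthogonal_span_singleton hx0
  set b := (stdOrthonormalBasis ℝ (ℝ ∙ x)ᗮ).reindex (finCongr hfr)
  refine ⟨fun i => (b i : PhaseSpace n), ?_, fun i => ?_⟩
  · exact b.orthonormal.comp_linearIsometry (ℝ ∙ x)ᗮ.subtypeₗᵢ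
  · exact Submodule.mem_orthogonal_singleton_iff_inner_right.1 (b i).2

theorem orthonormal_cons {m : ℕ} {x : PhaseSpace n} (hx : ‖x‖ = 1) {e : Fin m → PhaseSpace n}
    (he : Orthonormal ℝ e) (hxe : ∀ i, inner ℝ x (e i) = 0) :
    Orthonormal ℝ (Fin.cons x e : Fin (m + 1) → PhaseSpace n) := by
  refine ⟨fun i => Fin.cases hx he.1 i, fun i j => ?_⟩
  refine Fin.cases (fun hij => ?_) (fun i hij => ?_) i <;> revert hij <;>
    refine Fin.cases (fun hij => ?_) (fun j hij => ?_) j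
  · exact absurd rfl hij
  · exact hxe j
  · exact (real_inner_comm _ _).trans (hxe i)
  · exact he.2 fun h => hij (congrArg Fin.succ h)

/-- The value of the volume density: it is a constant multiple of `H⁻ⁿ`. -/
theorem volumeDensity_eq (hn : 1 ≤ n) {H : PhaseSpace n → ℝ} (hH : IsStarHamiltonian H)
    {x : PhaseSpace n} (hx : ‖x‖ = 1) :
    volumeDensity H x = ENNReal.ofReal
      (|contactAlternating n (n - 1) (frameBasis n hn)| * (H x)⁻¹ ^ n) := by
  have hx0 : x ≠ 0 := fun h => by simp [h] at hx
  have hHx := hH.pos hx0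
  have hsq := Real.sqrt_pos.2 hHx
  set ρ : PhaseSpace n → ℝ := fun y => (Real.sqrt (H y))⁻¹ with hρ
  have hρd : DifferentiableAt ℝ ρ x :=
    ((hH.hasFDerivAt hx0).differentiableAt.sqrt hHx.ne').inv hsq.ne'
  have hρx : 0 < ρ x := inv_pos.2 hsq
  have hrad : ∀ v, fderiv ℝ (radialMap H) x v = ρ x • (v + (fderiv ℝ ρ x v / ρ x) • x) := by
    intro v
    have h1 : HasFDerivAt (radialMap H) (ρ x • ContinuousLinearMap.id ℝ (PhaseSpace n) +
        (fderiv ℝ ρ x).smulRight x) x := hρd.hasFDerivAt.smul (hasFDerivAt_id x)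
    rw [h1.fderiv]
    simp only [add_apply, smul_apply, ContinuousLinearMap.id_apply,
      ContinuousLinearMap.smulRight_apply, smul_add, smul_smul]
    rw [mul_div_cancel₀ _ hρx.ne']
  have hpow : ρ x ^ (2 * (n - 1) + 1 + 1) = (H x)⁻¹ ^ n := by
    rw [show 2 * (n - 1) + 1 + 1 = 2 * n by omega, pow_mul, hρ]
    simp only [inv_pow, Real.sq_sqrt hHx.le]
  have hval : ∀ e ∈ tangentFrames x,
      |contactTopForm (n - 1) (radialMap H x) (fun i => fderiv ℝ (radialMap H) x (e i))| =
        |contactAlternating n (n - 1) (frameBasis n hn)| * (H x)⁻¹ ^ n := by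
    intro e he
    have h1 : (Fin.cons (radialMap H x) (fun i => fderiv ℝ (radialMap H) x (e i)) :
        Fin (2 * (n - 1) + 1 + 1) → PhaseSpace n) = fun i => ρ x •
        (Fin.cons x (fun i => e i + (fderiv ℝ ρ x (e i) / ρ x) • x) :
          Fin (2 * (n - 1) + 1 + 1) → PhaseSpace n) i := by
      funext i
      refine Fin.cases rfl (fun i => ?_) i
      simp only [Fin.cons_succ, hrad]
    rw [← contactAlternating_cons, h1,
      ← AlternatingMap.coe_multilinearMap, MultilinearMap.map_smul_univ,
      AlternatingMap.coe_multilinearMap, contactAlternating_cons_add hn, Finset.prod_const,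
      Finset.card_univ, Fintype.card_fin, hpow, smul_eq_mul, abs_mul,
      abs_contactAlternating_of_orthonormal hn (orthonormal_cons hx he.1 he.2), mul_comm,
      abs_of_pos (a := (H x)⁻¹ ^ n) (by positivity)]
  rw [volumeDensity, biSup_congr fun e he => by rw [hval e he]]
  exact biSup_const (tangentFrames_nonempty hn hx)

/-- The volume of a sublevel set in polar coordinates. -/
theorem volume_sublevel_eq (hn : 1 ≤ n) {H : PhaseSpace n → ℝ} (hH : IsStarHamiltonian H) :
    volume {x | H x < 1} = ∫⁻ x : Metric.sphere (0 : PhaseSpace n) 1,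
      ENNReal.ofReal ((H x)⁻¹ ^ n / (2 * n)) ∂(volume : Measure (PhaseSpace n)).toSphere := by
  have hsph : ∀ x : Metric.sphere (0 : PhaseSpace n) 1, (x : PhaseSpace n) ≠ 0 :=
    fun x => sphere_subset_compl_zero x.2
  have hsq : ∀ x : Metric.sphere (0 : PhaseSpace n) 1, 0 < (Real.sqrt (H x))⁻¹ :=
    fun x => inv_pos.2 (Real.sqrt_pos.2 (hH.pos (hsph x)))
  have hcont : Continuous fun x : Metric.sphere (0 : PhaseSpace n) 1 => (Real.sqrt (H x))⁻¹ := by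
    have h1 : Continuous fun x : Metric.sphere (0 : PhaseSpace n) 1 => H x :=
      (hH.smooth.continuousOn.mono sphere_subset_compl_zero).domRestrict
    exact (Real.continuous_sqrt.comp h1).inv₀ fun x => (inv_pos.1 (hsq x)).ne'
  set P : Set (Metric.sphere (0 : PhaseSpace n) 1 × Ioi (0 : ℝ)) :=
    {z | (z.2 : ℝ) < (Real.sqrt (H z.1))⁻¹} with hP
  have hPo : IsOpen P := isOpen_lt (by fun_prop) (hcont.comp continuous_fst)
  have hpre : homeomorphUnitSphereProd (PhaseSpace n) ⁻¹' P =
      ((↑) : ({0}ᶜ : Set (PhaseSpace n)) → PhaseSpace n) ⁻¹' {x | H x < 1} := by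
    ext ⟨x, hx⟩
    have hx0 : x ≠ 0 := hx
    have hnx := norm_pos_iff.2 hx0
    simp only [hP, mem_preimage, mem_ofPred_eq, homeomorphUnitSphereProd_apply_snd_coe,
      homeomorphUnitSphereProd_apply_fst_coe]
    rw [hH.homogeneous _ (inv_pos.2 hnx), Real.sqrt_mul (by positivity),
      Real.sqrt_sq (by positivity), mul_inv, inv_inv]
    rw [lt_mul_iff_one_lt_right hnx, one_lt_inv_iff₀, Real.sqrt_lt' one_pos, one_pow]
    exact ⟨fun h => h.2, fun h => ⟨Real.sqrt_pos.2 (hH.pos hx0), h⟩⟩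
  have hzero : volume {x | H x < 1} = volume.comap
      ((↑) : ({0}ᶜ : Set (PhaseSpace n)) → PhaseSpace n) (homeomorphUnitSphereProd _ ⁻¹' P) := by
    have : Nontrivial (PhaseSpace n) := Module.nontrivial_of_finrank_pos (R := ℝ)
      (by rw [finrank_phaseSpace n hn]; omega)
    rw [hpre, comap_subtype_coe_apply (measurableSet_singleton _).compl,
      Subtype.image_preimage_coe, inter_comm, ← sdiff_eq,
      measure_sdiff_null (measure_singleton _)]
  rw [hzero, (Measure.measurePreserving_homeomorphUnitSphereProd volume).measure_preimage
    hPo.measurableSet.nullMeasurableSet, Measure.prod_apply hPo.measurableSet]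
  refine lintegral_congr fun x => ?_
  have hsec : Prod.mk x ⁻¹' P = Iio ⟨(Real.sqrt (H x))⁻¹, hsq x⟩ := rfl
  rw [hsec, Measure.volumeIoiPow_apply_Iio, finrank_phaseSpace n hn]
  congr 1
  simp only [Nat.add_sub_cancel]
  rw [show 2 * (n - 1) + 1 + 1 = 2 * n by omega, pow_mul, inv_pow,
    Real.sq_sqrt (hH.nonneg x)]
  congr 1
  have h2 : (((2 * (n - 1) + 1 : ℕ) : ℝ)) + 1 = ((2 * n : ℕ) : ℝ) := by
    rw [← Nat.cast_add_one]
    congr 1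
    omega
  rw [h2]
  push_cast
  rfl

/-- The contact volume of `{H = 1}` is a constant multiple of the Lebesgue measure of `{H < 1}`. -/
theorem exists_contactVolume_eq (hn : 1 ≤ n) :
    ∃ C : ℝ≥0∞, ∀ H : PhaseSpace n → ℝ, IsStarHamiltonian H →
      contactVolume H = C * volume {x | H x < 1} := by
  set c := |contactAlternating n (n - 1) (frameBasis n hn)| with hc
  refine ⟨(n.factorial : ℝ≥0∞)⁻¹ * ENNReal.ofReal (c * (2 * n)), fun H hH => ?_⟩
  rw [contactVolume, mul_assoc, volume_sublevel_eq hn hH,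
    ← lintegral_const_mul' _ _ ENNReal.ofReal_ne_top]
  congr 1
  refine lintegral_congr fun x => ?_
  rw [volumeDensity_eq hn hH (by simp), ← hc, ← ENNReal.ofReal_mul (by positivity)]
  congr 1
  have : (n : ℝ) ≠ 0 := by positivity
  field_simp

end ContactVolume

section Invariance

/-- A linear symplectic map preserves volume. -/
theorem abs_det_eq_one_of_symplectic {D : PhaseSpace n →L[ℝ] PhaseSpace n}
    (hD : ∀ u v, inner ℝ (rotation (D u)) (D v) = inner ℝ (rotation u) v) : |D.det| = 1 := by
  set A : PhaseSpace n →ₗ[ℝ] PhaseSpace n := D.toLinearMap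
  set J : PhaseSpace n →ₗ[ℝ] PhaseSpace n :=
    (rotation : PhaseSpace n →L[ℝ] PhaseSpace n).toLinearMap
  have h1 : LinearMap.adjoint A * (J * A) = J := by
    refine LinearMap.ext fun u => ext_inner_right ℝ fun v => ?_
    rw [Module.End.mul_apply, LinearMap.adjoint_inner_left]
    exact hD u v
  have hadj : LinearMap.det (LinearMap.adjoint A) = LinearMap.det A := by
    set b := stdOrthonormalBasis ℝ (PhaseSpace n)
    rw [← LinearMap.det_toMatrix b.toBasis, LinearMap.toMatrix_adjoint b b,
      Matrix.det_conjTranspose, LinearMap.det_toMatrix]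
    simp
  have hJ : LinearMap.det J ≠ 0 := by
    have h2 : J * (-J) = 1 := LinearMap.ext fun u => by
      change rotation (-(rotation u)) = u
      simp
    intro h0
    have h3 := congrArg LinearMap.det h2
    rw [map_mul, h0, zero_mul, map_one] at h3
    exact zero_ne_one h3
  have h4 := congrArg LinearMap.det h1
  rw [map_mul, map_mul, hadj] at h4
  have h5 : LinearMap.det A ^ 2 = 1 := by
    refine mul_right_cancel₀ hJ ?_
    linear_combination h4
  change |LinearMap.det A| = 1
  rw [← sq_eq_sq₀ (abs_nonneg _) zero_le_one, sq_abs, h5, one_pow]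

/-- **Liouville's theorem**: symplectic maps preserve the volume of sublevel sets. -/
theorem IsSymplecticFamily.volume_sublevel {ε : ℝ} {Ψ Ψi : ℝ → PhaseSpace n → PhaseSpace n}
    (h : IsSymplecticFamily ε Ψ Ψi) (hn : 1 ≤ n) {t : ℝ} (ht : t ∈ Ioo (-ε) ε)
    {K : PhaseSpace n → ℝ} (hK : IsHomogeneousSmooth K) :
    volume {x | K (Ψi t x) < 1} = volume {x | K x < 1} := by
  have : Nontrivial (PhaseSpace n) := Module.nontrivial_of_finrank_pos (R := ℝ)
    (by rw [finrank_phaseSpace n hn]; omega)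
  have hs : MeasurableSet ({0}ᶜ ∩ K ⁻¹' Iio 1) :=
    (hK.smooth.continuousOn.isOpen_inter_preimage isOpen_compl_zero isOpen_Iio).measurableSet
  have himage : Ψ t '' ({0}ᶜ ∩ K ⁻¹' Iio 1) = {x | K (Ψi t x) < 1} \ {0} := by
    ext y
    constructor
    · rintro ⟨x, ⟨hx0, hx⟩, rfl⟩
      refine ⟨?_, h.ne_zero ht hx0⟩
      rw [mem_ofPred_eq, h.left_inv t ht]
      exact hx
    · rintro ⟨hy, hy0⟩
      exact ⟨Ψi t y, ⟨h.inv_ne_zero ht hy0, hy⟩, h.right_inv t ht y⟩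
  have hcv := lintegral_abs_det_fderiv_eq_addHaar_image volume hs
    (fun x hx => (h.hasFDerivAt ht hx.1).hasFDerivWithinAt)
    (fun x _ y _ hxy => by rw [← h.left_inv t ht x, hxy, h.left_inv t ht])
  rw [himage, measure_sdiff_null (measure_singleton _)] at hcv
  rw [← hcv, setLIntegral_congr_fun hs fun x hx => by
    rw [abs_det_eq_one_of_symplectic (h.symplectic t ht x hx.1), ENNReal.ofReal_one],
    setLIntegral_one, inter_comm, ← sdiff_eq, measure_sdiff_null (measure_singleton _)]
  rfl

end Invariance

/-! ### Short orbits and the systolic inequality -/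

section Systole

theorem systole_le {H : PhaseSpace n → ℝ} {c : ℝ → PhaseSpace n} (hc : IsCharacteristic H c)
    {T : ℝ} (hT : 0 < T) (hper : Function.Periodic c T) : systole H ≤ ENNReal.ofReal T := by
  have h := action_eq hc T
  calc systole H ≤ ENNReal.ofReal (action c T) :=
        iInf_le_of_le c <| iInf_le_of_le T <| iInf_le _ ⟨hc, hT, hper⟩
    _ = ENNReal.ofReal T := by rw [h]

/-- Symplectic maps carry characteristics to characteristics. -/
theorem IsSymplecticFamily.isCharacteristic_comp {ε : ℝ} {Ψ Ψi : ℝ → PhaseSpace n → PhaseSpace n}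
    (h : IsSymplecticFamily ε Ψ Ψi) {t : ℝ} (ht : t ∈ Ioo (-ε) ε) {K : PhaseSpace n → ℝ}
    (hK : IsHomogeneousSmooth K) (hKΨ : IsHomogeneousSmooth fun x => K (Ψi t x))
    {c : ℝ → PhaseSpace n} (hc : IsCharacteristic K c) :
    IsCharacteristic (fun x => K (Ψi t x)) (fun s => Ψ t (c s)) := by
  obtain ⟨h1, h2⟩ := (isCharacteristic_iff hK).1 hc
  refine (isCharacteristic_iff hKΨ).2 ⟨fun s => by rw [h.left_inv t ht, h1], fun s => ?_⟩
  have hcs : c s ≠ 0 := fun h0 => by simpa [h0, hK.map_zero] using h1 s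
  have hd := h.hasFDerivAt ht hcs
  have hdi : HasFDerivAt (Ψi t) (fderiv ℝ (Ψi t) (Ψ t (c s))) (Ψ t (c s)) :=
    (((contDiffOn_slice h.smooth_inv ht).contDiffAt
      (isOpen_compl_zero.mem_nhds (h.ne_zero ht hcs))).differentiableAt (by simp)).hasFDerivAt
  have hKd : HasFDerivAt K (fderiv ℝ K (c s)) (Ψi t (Ψ t (c s))) := by
    rw [h.left_inv t ht]
    exact hK.hasFDerivAt hcs
  have hd' : HasFDerivAt (Ψ t) (fderiv ℝ (Ψ t) (c s)) (Ψi t (Ψ t (c s))) := by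
    rwa [h.left_inv t ht]
  suffices hX : fderiv ℝ (Ψ t) (c s) (hamField K (c s)) =
      hamField (fun x => K (Ψi t x)) (Ψ t (c s)) from hX ▸ hd.comp_hasDerivAt s (h2 s)
  refine eq_hamField_iff.2 fun v => ?_
  have hv : fderiv ℝ (Ψ t) (c s) (fderiv ℝ (Ψi t) (Ψ t (c s)) v) = v := by
    have h3 := hd'.comp (Ψ t (c s)) hdi
    rw [show Ψ t ∘ Ψi t = id from funext (h.right_inv t ht)] at h3
    exact congrArg (fun A : PhaseSpace n →L[ℝ] PhaseSpace n => A v)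
      (h3.unique (hasFDerivAt_id _))
  have h4 : fderiv ℝ (fun x => K (Ψi t x)) (Ψ t (c s)) =
      (fderiv ℝ K (c s)).comp (fderiv ℝ (Ψi t) (Ψ t (c s))) := (hKd.comp _ hdi).fderiv
  conv_lhs => rw [← hv]
  rw [h.symplectic t ht _ hcs, inner_rotation_hamField, h4, ContinuousLinearMap.comp_apply]

/-- The maximum of `K / H₀`, for positive homogeneous functions. -/
theorem exists_isMax_ratio (hn : 1 ≤ n) {H₀ K : PhaseSpace n → ℝ} (hH₀ : IsStarHamiltonian H₀)
    (hK : IsStarHamiltonian K) :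
    ∃ M > 0, ∃ x, H₀ x = 1 ∧ K x = M ∧ ∀ y, K y ≤ M * H₀ y := by
  have : Nontrivial (PhaseSpace n) := Module.nontrivial_of_finrank_pos (R := ℝ)
    (by rw [finrank_phaseSpace n hn]; omega)
  obtain ⟨u, hu, hmax⟩ := (isCompact_sphere (0 : PhaseSpace n) 1).exists_isMaxOn
    (NormedSpace.sphere_nonempty.2 zero_le_one) (f := fun x => K x / H₀ x)
    ((hK.smooth.continuousOn.mono sphere_subset_compl_zero).div
      (hH₀.smooth.continuousOn.mono sphere_subset_compl_zero)
      fun x hx => (hH₀.pos (sphere_subset_compl_zero hx)).ne')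
  have hu0 : u ≠ 0 := sphere_subset_compl_zero hu
  have hHu := hH₀.pos hu0
  have hsq : ((Real.sqrt (H₀ u))⁻¹) ^ 2 = (H₀ u)⁻¹ := by rw [inv_pow, Real.sq_sqrt hHu.le]
  have hpos : 0 < (Real.sqrt (H₀ u))⁻¹ := inv_pos.2 (Real.sqrt_pos.2 hHu)
  refine ⟨K u / H₀ u, div_pos (hK.pos hu0) hHu, (Real.sqrt (H₀ u))⁻¹ • u, ?_, ?_, fun y => ?_⟩
  · rw [hH₀.homogeneous _ hpos, hsq, inv_mul_cancel₀ hHu.ne']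
  · rw [hK.homogeneous _ hpos, hsq, div_eq_inv_mul]
  · rcases eq_or_ne y 0 with rfl | hy
    · rw [hH₀.map_zero, hK.map_zero, mul_zero]
    · obtain ⟨v, hv, hvy⟩ := norm_smul_normalize hy
      have h1 : K v ≤ K u / H₀ u * H₀ v :=
        (div_le_iff₀ (hH₀.pos (sphere_subset_compl_zero hv))).1 (hmax hv)
      rw [← hvy, hK.homogeneous _ (norm_pos_iff.2 hy), hH₀.homogeneous _ (norm_pos_iff.2 hy)]
      calc ‖y‖ ^ 2 * K v ≤ ‖y‖ ^ 2 * (K u / H₀ u * H₀ v) := by gcongr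
        _ = _ := by ring

/-- An integral of motion `K` of the periodic flow of `H₀` that is bounded by `M H₀`, with equality
at a point, has a closed characteristic of period `T / M`: at the points of the orbit the function
`M H₀ - K` is minimal, so that the Hamiltonian vector field of `K` is `M` times that of `H₀`. -/
theorem exists_isCharacteristic_of_isMax {H₀ K : PhaseSpace n → ℝ} {T : ℝ}
    {γ : PhaseSpace n → ℝ → PhaseSpace n} (hγ : IsPeriodicHamiltonianFlow H₀ T γ)
    (hH₀ : IsHomogeneousSmooth H₀) (hK : IsHomogeneousSmooth K)
    (hinv : ∀ x ≠ 0, ∀ s, K (γ x s) = K x) {M : ℝ} (hM : 0 < M) {x : PhaseSpace n}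
    (hx : H₀ x = 1) (hKx : K x = M) (hle : ∀ y, K y ≤ M * H₀ y) :
    ∃ c, IsCharacteristic K c ∧ Function.Periodic c (T / M) := by
  have hx0 : x ≠ 0 := fun h0 => by simp [h0, hH₀.map_zero] at hx
  have hγ0 : ∀ s, γ x s ≠ 0 := fun s => hγ.flow.mem x hx0 s
  have hfield : ∀ s, hamField K (γ x s) = M • hamField H₀ (γ x s) := by
    intro s
    have hmin : IsLocalMin (fun y => M * H₀ y - K y) (γ x s) := Eventually.of_forall fun y => by
      have h1 : M * H₀ (γ x s) - K (γ x s) = 0 := by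
        rw [hγ.energy x hx0, hinv x hx0, hx, hKx, mul_one, sub_self]
      simpa [h1] using hle y
    have hd := hmin.hasFDerivAt_eq_zero
      (((hH₀.hasFDerivAt (hγ0 s)).const_mul M).sub (hK.hasFDerivAt (hγ0 s)))
    rw [hamField, ← sub_eq_zero.1 hd]
    simp [hamField]
  -- The factor that moves the orbit from the level `{K = M}` to the level `{K = 1}`.
  set r : ℝ := (Real.sqrt M)⁻¹
  have hr : 0 < r := inv_pos.2 (Real.sqrt_pos.2 hM)
  have hr2 : r ^ 2 * M = 1 := by
    rw [inv_pow, Real.sq_sqrt hM.le, inv_mul_cancel₀ hM.ne']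
  refine ⟨fun s => r • γ x (M * s), (isCharacteristic_iff hK).2 ⟨fun s => ?_, fun s => ?_⟩,
    fun s => ?_⟩
  · rw [hK.homogeneous r hr, hinv x hx0, hKx, hr2]
  · have h1 : HasDerivAt (γ x) (hamField H₀ (γ x (M * s))) (M * s) := hγ.flow.deriv x hx0 _
    have h2 : HasDerivAt (fun s => M * s) M s := by simpa using (hasDerivAt_id s).const_mul M
    rw [hK.hamField_smul hr, hfield]
    exact (h1.scomp s h2).const_smul r
  · have h1 := hγ.periodic x hx0 (M * s)
    have h2 : M * (s + T / M) = M * s + T := by field_simp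
    change r • γ x (M * (s + T / M)) = r • γ x (M * s)
    rw [h2, h1]

/-- If `K ≤ M H₀`, then the volume of `{K < 1}` is at least that of `{M H₀ < 1}`. -/
theorem mul_volume_sublevel_le (hn : 1 ≤ n) {H₀ K : PhaseSpace n → ℝ}
    (hH₀ : IsHomogeneousSmooth H₀) {M : ℝ} (hM : 0 < M) (hle : ∀ y, K y ≤ M * H₀ y) :
    ENNReal.ofReal M⁻¹ ^ n * volume {x | H₀ x < 1} ≤ volume {x | K x < 1} := by
  set r : ℝ := (Real.sqrt M)⁻¹
  have hr : 0 < r := inv_pos.2 (Real.sqrt_pos.2 hM)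
  have hr2 : r ^ 2 = M⁻¹ := by rw [inv_pow, Real.sq_sqrt hM.le]
  have hv := Measure.addHaar_smul (volume : Measure (PhaseSpace n)) r {x | H₀ x < 1}
  rw [finrank_phaseSpace n hn, abs_of_nonneg (by positivity),
    show 2 * (n - 1) + 1 + 1 = 2 * n by omega, pow_mul, hr2,
    ENNReal.ofReal_pow (inv_nonneg.2 hM.le)] at hv
  rw [← hv]
  refine measure_mono ?_
  rintro _ ⟨y, hy, rfl⟩
  have h1 := hle (r • y)
  rw [hH₀.homogeneous r hr, hr2, mul_inv_cancel_left₀ hM.ne'] at h1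
  exact h1.trans_lt hy

/-- The systolic inequality for an integral of motion of a periodic flow, transported by a
symplectic map. The factor `M⁻ⁿ` of the volume is compensated by the factor `M⁻¹` of the period,
where `M` is the maximum of `K / H₀`. -/
theorem systolicVolume_le (hn : 1 ≤ n) {H₀ K : PhaseSpace n → ℝ} {T : ℝ} (hT0 : 0 < T)
    (hT : systole H₀ = ENNReal.ofReal T)
    {γ : PhaseSpace n → ℝ → PhaseSpace n} (hγ : IsPeriodicHamiltonianFlow H₀ T γ)
    (hH₀ : IsStarHamiltonian H₀) (hK : IsStarHamiltonian K)
    (hinv : ∀ x ≠ 0, ∀ s, K (γ x s) = K x) {ε t : ℝ} {Ψ Ψi : ℝ → PhaseSpace n → PhaseSpace n}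
    (h : IsSymplecticFamily ε Ψ Ψi) (ht : t ∈ Ioo (-ε) ε)
    (hKΨ : IsStarHamiltonian fun x => K (Ψi t x)) :
    systolicVolume H₀ ≤ systolicVolume fun x => K (Ψi t x) := by
  obtain ⟨M, hM, x, hx, hKx, hle⟩ := exists_isMax_ratio hn hH₀ hK
  obtain ⟨c, hc, hper⟩ := exists_isCharacteristic_of_isMax hγ hH₀.toIsHomogeneousSmooth
    hK.toIsHomogeneousSmooth hinv hM hx hKx hle
  obtain ⟨C, hC⟩ := exists_contactVolume_eq hn
  have hsys : systole (fun x => K (Ψi t x)) ≤ ENNReal.ofReal M⁻¹ * ENNReal.ofReal T := by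
    refine (systole_le (h.isCharacteristic_comp ht hK.toIsHomogeneousSmooth
      hKΨ.toIsHomogeneousSmooth hc) (div_pos hT0 hM) fun s => by rw [hper]).trans_eq ?_
    rw [← ENNReal.ofReal_mul (inv_nonneg.2 hM.le), div_eq_inv_mul]
  have hMpos : 0 < ENNReal.ofReal M⁻¹ := ENNReal.ofReal_pos.2 (inv_pos.2 hM)
  calc systolicVolume H₀ = (C * volume {x | H₀ x < 1}) / ENNReal.ofReal T ^ n := by
        rw [systolicVolume, hC H₀ hH₀, hT]
    _ = ENNReal.ofReal M⁻¹ ^ n * (C * volume {x | H₀ x < 1}) /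
          (ENNReal.ofReal M⁻¹ ^ n * ENNReal.ofReal T ^ n) :=
        (ENNReal.mul_div_mul_left _ _ (pow_ne_zero n hMpos.ne')
          (ENNReal.pow_ne_top ENNReal.ofReal_ne_top)).symm
    _ ≤ systolicVolume fun x => K (Ψi t x) := by
        rw [systolicVolume, hC _ hKΨ, h.volume_sublevel hn ht hK.toIsHomogeneousSmooth,
          ← mul_pow, mul_left_comm]
        gcongr
        exact mul_volume_sublevel_le hn hH₀.toIsHomogeneousSmooth hM hle

end Systole

section Family

variable {ε : ℝ}

/-- A homogeneous family that is positive at `t = 0` stays positive for small `t`. -/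
theorem IsHomogeneousFamily.exists_isStarHamiltonian {K : ℝ → PhaseSpace n → ℝ}
    (hK : IsHomogeneousFamily ε K) (hε : 0 < ε)
    (h0 : ∀ x ∈ Metric.sphere (0 : PhaseSpace n) 1, 0 < K 0 x) :
    ∃ δ > 0, δ ≤ ε ∧ ∀ t ∈ Ioo (-δ) δ, IsStarHamiltonian (K t) := by
  have hev : ∀ᶠ t in 𝓝 (0 : ℝ), ∀ x ∈ Metric.sphere (0 : PhaseSpace n) 1, 0 < K t x := by
    refine (isCompact_sphere (0 : PhaseSpace n) 1).eventually_forall_of_forall_eventually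
      fun x hx => ?_
    have hmem : ((0 : ℝ), x) ∈ Ioo (-ε) ε ×ˢ ({0}ᶜ : Set (PhaseSpace n)) :=
      ⟨⟨neg_lt_zero.2 hε, hε⟩, sphere_subset_compl_zero hx⟩
    have hc : ContinuousAt (fun z : ℝ × PhaseSpace n => K z.1 z.2) (0, x) :=
      (hK.smooth.contDiffAt ((isOpen_Ioo_prod_compl_zero ε).mem_nhds hmem)).continuousAt
    exact hc.eventually (lt_mem_nhds (h0 x hx))
  obtain ⟨δ, hδ, hb⟩ := Metric.eventually_nhds_iff_ball.1 hev
  refine ⟨min δ ε, lt_min hδ hε, min_le_right _ _, fun t ht => ?_⟩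
  have h1 := min_le_left δ ε
  have h2 := min_le_right δ ε
  have htε : t ∈ Ioo (-ε) ε := ⟨by linarith [ht.1], by linarith [ht.2]⟩
  refine (hK.isHomogeneousSmooth htε).isStarHamiltonian (hb t ?_)
  rw [Real.ball_eq_Ioo]
  exact ⟨by linarith [ht.1], by linarith [ht.2]⟩

theorem IsHomogeneousFamily.exists_bound {R : ℝ → PhaseSpace n → ℝ}
    (hR : IsHomogeneousFamily ε R) (hε : 0 < ε) :
    ∃ C, ∀ᶠ t in 𝓝 (0 : ℝ), ∀ x, |R t x| ≤ C * ‖x‖ ^ 2 := by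
  have hsub : Icc (-(ε / 2)) (ε / 2) ⊆ Ioo (-ε) ε := fun t ht =>
    ⟨by linarith [ht.1], by linarith [ht.2]⟩
  obtain ⟨C, hC⟩ :=
    (isCompact_Icc.prod (isCompact_sphere (0 : PhaseSpace n) 1)).exists_bound_of_continuousOn
      (hR.smooth.continuousOn.mono (prod_mono hsub sphere_subset_compl_zero))
  refine ⟨C, ?_⟩
  filter_upwards [Icc_mem_nhds (show -(ε / 2) < 0 by linarith) (show 0 < ε / 2 by linarith)]
    with t ht x
  rcases eq_or_ne x 0 with rfl | hx
  · simp [(hR.isHomogeneousSmooth (hsub ht)).map_zero]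
  · obtain ⟨u, hu, hux⟩ := norm_smul_normalize hx
    conv_lhs => rw [← hux]
    rw [hR.homogeneous t (hsub ht) _ (norm_pos_iff.2 hx), abs_mul, abs_of_nonneg (sq_nonneg _),
      mul_comm]
    exact mul_le_mul_of_nonneg_right (hC (t, u) ⟨ht, hu⟩) (sq_nonneg _)

end Family

end Starshaped

open Starshaped in
theorem mainTheorem1 (n : ℕ) (hn : 1 ≤ n)
    (H₀ : Starshaped.PhaseSpace n → ℝ) (hH₀ : Starshaped.IsStarHamiltonian H₀)
    (T : ℝ) (hT : Starshaped.systole H₀ = ENNReal.ofReal T)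
    (hper : Starshaped.HasPeriodicReebFlow H₀ T)
    (N : ℕ) (J : Fin N → Starshaped.PhaseSpace n → ℝ)
    (hJ : ∀ i, Starshaped.IsHomogeneousSmooth (J i)) :
    ∃ (ε : ℝ) (H : ℝ → Starshaped.PhaseSpace n → ℝ),
      0 < ε ∧
      H 0 = H₀ ∧
      (∀ t ∈ Set.Ioo (-ε) ε, Starshaped.IsStarHamiltonian (H t)) ∧
      ContDiffOn ℝ ∞ (fun z : ℝ × Starshaped.PhaseSpace n => H z.1 z.2)
        (Set.Ioo (-ε) ε ×ˢ {0}ᶜ) ∧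
      (∀ η : ℝ, 0 < η → ∀ᶠ t in 𝓝 (0 : ℝ), ∀ x : Starshaped.PhaseSpace n,
        |H t x - (H₀ x + ∑ i : Fin N, t ^ ((i : ℕ) + 1) * J i x)| ≤ η * |t| ^ N * ‖x‖ ^ 2) ∧
      (∀ t ∈ Set.Ioo (-ε) ε, Starshaped.systolicVolume H₀ ≤ Starshaped.systolicVolume (H t)) := by
  obtain ⟨γ, hγ⟩ := hper.exists_flow hH₀
  obtain ⟨ε, Ψ, Ψi, K, R, h⟩ :=
    exists_isNormalForm hH₀.toIsHomogeneousSmooth hper.1 hγ hJ N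
  have hε := h.pos
  obtain ⟨δ, hδ, hδε, hstarK⟩ := h.main.exists_isStarHamiltonian hε fun x hx => by
    rw [h.main_zero]
    exact hH₀.pos (sphere_subset_compl_zero hx)
  have hH := h.main.comp_inv h.family
  have hsub : Ioo (-δ) δ ⊆ Ioo (-ε) ε := Ioo_subset_Ioo (neg_le_neg hδε) hδε
  have hstar : ∀ t ∈ Ioo (-δ) δ, IsStarHamiltonian fun x => K t (Ψi t x) := fun t ht =>
    (hH.isHomogeneousSmooth (hsub ht)).isStarHamiltonian fun x hx =>
      (hstarK t ht).pos (h.family.inv_ne_zero (hsub ht) (sphere_subset_compl_zero hx))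
  refine ⟨δ, fun t x => K t (Ψi t x), hδ, ?_, hstar, (hH.mono hδε).smooth, ?_, fun t ht =>
    systolicVolume_le hn hper.1 hT hγ hH₀ (hstarK t ht) (h.invariant t (hsub ht)) h.family
      (hsub ht) (hstar t ht)⟩
  · funext x
    change K 0 (Ψi 0 x) = H₀ x
    rw [h.family.zero_inv_apply hε, h.main_zero]
  · intro η hη
    obtain ⟨C, hC⟩ := (h.remainder.comp_inv h.family).exists_bound hε
    have hsmall : ∀ᶠ t in 𝓝 (0 : ℝ), |t| * C < η := by
      have h1 : Tendsto (fun t : ℝ => |t| * C) (𝓝 0) (𝓝 0) := by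
        have : Continuous fun t : ℝ => |t| * C := by fun_prop
        simpa using this.tendsto 0
      exact h1.eventually (gt_mem_nhds hη)
    filter_upwards [hC, hsmall, Ioo_mem_nhds (neg_lt_zero.2 hε) hε] with t h1 h2 ht x
    have h3 := h.eq t ht (Ψi t x)
    rw [h.family.right_inv t ht] at h3
    rw [h3, sub_add_cancel_left, abs_neg, abs_mul, abs_pow]
    calc |t| ^ (N + 1) * |R t (Ψi t x)| ≤ |t| ^ (N + 1) * (C * ‖x‖ ^ 2) := by
          gcongr
          exact h1 x
      _ = (|t| * C) * (|t| ^ N * ‖x‖ ^ 2) := by ring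
      _ ≤ η * (|t| ^ N * ‖x‖ ^ 2) := by gcongr
      _ = η * |t| ^ N * ‖x‖ ^ 2 := by ring
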